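/- Let $p,s\in\mathbb N$ with $s-1>p>2$, let $\lambda\in[0,1]$ and $\xi(x)=\lambda x^p+(1-\lambda)x^s$. Let $\mathcal K$ be the set of measures on $[0,1]$ of the form $\nu(dx)=\mathbb 1_{[0,1)}(x)\gamma(x)\,dx+\Delta\,\delta_{\{1\}}(dx)$ with $\gamma$ nonnegative, nondecreasing and right-continuous on $[0,1)$ and $\Delta>0$, and let $$\mathcal Q(\nu)=\frac12\left(\int_{[0,1]}\xi'(x)\,\nu(dx)+\int_0^1\frac{dx}{\nu((x,1])}\right)\in[0,\infty].$$ The Parisi measure at zero temperature is the minimizer $\nu_P$ of $\mathcal Q$ over $\mathcal K$. Write $\rho_P$ for the measure on $[0,1)$ with $\rho_P([0,x])=\gamma_P(x)$ for $x\in[0,1)$. The model $\xi$ is $2$-RSB at zero temperature if the support of $\rho_P$ in $[0,1)$, together with the point $1$, consists of exactly $3$ points. For $q\in(0,1)$ and $z_2>0$ put $$f_1(q,z_2)=-\frac{[q\xi'(q)-\xi(q)](1-q)(1+z_2)}{\xi'(1)-\xi'(q)}-q^2\log\frac{q[\xi'(1)-\xi'(q)]}{(1+z_2)\xi'(q)(1-q)}+q^2-\frac{2\xi(q)q}{\xi'(q)}+\frac{\xi(q)q^2[\xi'(1)-\xi'(q)]}{(1+z_2)\xi'(q)^2(1-q)},$$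 $$f_2(q,z_2)=(1-q)[\xi'(1)-\xi'(q)]\left(\frac{1+z_2}{z_2^2}\log(1+z_2)-\frac1{z_2}\right)+\xi'(q)(1-q)-1+\xi(q).$$ Theorem. The model $\xi$ is $2$-RSB at zero temperature if and only if there exist $z_2>0$ and $q\in(0,1)$ such that $$\frac{\xi'(1)q}{\xi'(q)}<1+z_2\le\frac{\xi'(1)-\xi'(q)}{\xi''(q)(1-q)}\qquad\text{and}\qquad f_1(q,z_2)=f_2(q,z_2)=0.$$ Moreover, condition (4) of the Auffinger–Zeng criterion is redundant: if $q\in(0,1)$, $z_1>0$ and $z_2>\frac{(1-q)z_1}{q}$ satisfy (1) $1+z_1+z_2=\frac{q[\xi'(1)-\xi'(q)]}{\xi'(q)(1-q)}$, (2) $f_1(q,z_2)=f_2(q,z_2)=0$ and (3) $\xi''(q)(1+z_2)(1-q)\le\xi'(1)-\xi'(q)$, then (4) $h_1(1)>0$ and $h_2(0)<0$, where $h_1(x)=\xi'(x)(q+qz_1+qz_2-z_1x)-(1+z_2)\xi'(q)x$ and $h_2(x)=[\xi'(x)-\xi'(q)](1+z_2-q-z_2x)-(x-q)[\xi'(1)-\xi'(q)]$.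 -/

import Mathlib

open MeasureTheory Set

namespace SphericalSpinGlass

noncomputable section

/-- The mixture function `ξ(x) = λ x^p + (1 - λ) x^s` of the spherical `p + s` model. -/
def mixture (p s : ℕ) (lam : ℝ) : ℝ → ℝ := fun x => lam * x ^ p + (1 - lam) * x ^ s

/-- Admissible parameters: `γ` is nonnegative, nondecreasing and right-continuous on `[0, 1)`
(its values elsewhere play no role), and `Δ > 0`. -/
structure Admissible (γ : ℝ → ℝ) (Δ : ℝ) : Prop where
  nonneg : ∀ x ∈ Ico (0 : ℝ) 1, 0 ≤ γ x
  monotoneOn : MonotoneOn γ (Ico 0 1)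
  rightContinuous : ∀ x ∈ Ico (0 : ℝ) 1, ContinuousWithinAt γ (Ici x) x
  pos : 0 < Δ

/-- The measure `ν(dx) = 1_{[0,1)}(x) γ(x) dx + Δ δ_{1}(dx)`. -/
def orderMeasure (γ : ℝ → ℝ) (Δ : ℝ) : Measure ℝ :=
  (volume.restrict (Ico (0 : ℝ) 1)).withDensity (fun x => ENNReal.ofReal (γ x)) +
    ENNReal.ofReal Δ • Measure.dirac 1

/-- The class `𝒦` of measures over which the Parisi formula at zero temperature is minimized. -/
def orderMeasures : Set (Measure ℝ) :=
  {ν | ∃ (γ : ℝ → ℝ) (Δ : ℝ), Admissible γ Δ ∧ ν = orderMeasure γ Δ}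

/-- The Crisanti-Sommers functional
`𝒬(ν) = 1/2 (∫_{[0,1]} ξ'(x) ν(dx) + ∫_0^1 dx / ν((x, 1]))`, with values in `[0, ∞]`
(both integrands are nonnegative on `[0, 1]`). -/
def crisantiSommers (ξ : ℝ → ℝ) (ν : Measure ℝ) : ENNReal :=
  2⁻¹ * ((∫⁻ x in Icc (0 : ℝ) 1, ENNReal.ofReal (deriv ξ x) ∂ν) +
    ∫⁻ x in Icc (0 : ℝ) 1, (ν (Ioc x 1))⁻¹)

/-- `ν` is the Parisi measure at zero temperature: it minimizes the Crisanti-Sommers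
functional over `𝒦`. -/
def IsParisiMeasure (ξ : ℝ → ℝ) (ν : Measure ℝ) : Prop :=
  ν ∈ orderMeasures ∧ ∀ ν' ∈ orderMeasures, crisantiSommers ξ ν ≤ crisantiSommers ξ ν'

/-- `ρ` is the measure on `[0, 1)` induced by `γ`, i.e. `ρ([0, x]) = γ(x)` for `x ∈ [0, 1)`. -/
def IsInducedMeasure (γ : ℝ → ℝ) (ρ : Measure ℝ) : Prop :=
  ρ (Ico (0 : ℝ) 1)ᶜ = 0 ∧ ∀ x ∈ Ico (0 : ℝ) 1, ρ (Icc 0 x) = ENNReal.ofReal (γ x)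

/-- The model with mixture `ξ` is `k`-RSB at zero temperature: the Parisi measure is
`γ(x) 1_{[0,1)} dx + Δ δ_{1}`, and its support, that is the support in `[0, 1)` of the measure
`ρ` induced by `γ` together with the atom at `1`, has exactly `k + 1` points (a finite set is
in particular discrete). -/
def IsRSB (k : ℕ) (ξ : ℝ → ℝ) : Prop :=
  ∃ (γ : ℝ → ℝ) (Δ : ℝ) (ρ : Measure ℝ),
    Admissible γ Δ ∧ IsParisiMeasure ξ (orderMeasure γ Δ) ∧ IsInducedMeasure γ ρ ∧
      ((ρ.support ∩ Ico 0 1) ∪ {1}).encard = k + 1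

/-- The function `f₁(q, z₂)`. -/
def f1 (ξ : ℝ → ℝ) (q z₂ : ℝ) : ℝ :=
  -((q * deriv ξ q - ξ q) * (1 - q) * (1 + z₂) / (deriv ξ 1 - deriv ξ q))
    - q ^ 2 * Real.log (q * (deriv ξ 1 - deriv ξ q) / ((1 + z₂) * deriv ξ q * (1 - q)))
    + q ^ 2 - 2 * ξ q * q / deriv ξ q
    + ξ q * q ^ 2 * (deriv ξ 1 - deriv ξ q) / ((1 + z₂) * deriv ξ q ^ 2 * (1 - q))

/-- The function `f₂(q, z₂)`. -/
def f2 (ξ : ℝ → ℝ) (q z₂ : ℝ) : ℝ :=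
  (1 - q) * (deriv ξ 1 - deriv ξ q) * ((1 + z₂) / z₂ ^ 2 * Real.log (1 + z₂) - 1 / z₂)
    + deriv ξ q * (1 - q) - 1 + ξ q

/-- The function `h₁(x)` of the Auffinger-Zeng criterion. -/
def h1 (ξ : ℝ → ℝ) (q z₁ z₂ x : ℝ) : ℝ :=
  deriv ξ x * (q + q * z₁ + q * z₂ - z₁ * x) - (1 + z₂) * deriv ξ q * x

/-- The function `h₂(x)` of the Auffinger-Zeng criterion. -/
def h2 (ξ : ℝ → ℝ) (q z₂ x : ℝ) : ℝ :=
  (deriv ξ x - deriv ξ q) * (1 + z₂ - q - z₂ * x) - (x - q) * (deriv ξ 1 - deriv ξ q)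

/-- Conditions (1)-(3) of the Auffinger-Zeng criterion for two steps of replica symmetry
breaking. -/
structure AuffingerZeng (ξ : ℝ → ℝ) (q z₁ z₂ : ℝ) : Prop where
  q_mem : q ∈ Ioo (0 : ℝ) 1
  z₁_pos : 0 < z₁
  z₂_gt : (1 - q) * z₁ / q < z₂
  sum_eq : 1 + z₁ + z₂ = q * (deriv ξ 1 - deriv ξ q) / (deriv ξ q * (1 - q))
  f1_eq : f1 ξ q z₂ = 0
  f2_eq : f2 ξ q z₂ = 0
  second_order : deriv (deriv ξ) q * (1 + z₂) * (1 - q) ≤ deriv ξ 1 - deriv ξ q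

end

end SphericalSpinGlass

namespace SphericalSpinGlass

noncomputable section

/-! ### Sign patterns of the polynomials of the criterion -/

/-! For an order measure `ν` put `W(y) = ∫₀^y dx / ν((x,1])²` and `G = ξ' - W`. The first variation
of `𝒬` at `ν` is half the integral of `G` against the perturbation, and `𝒬` is convex. A 2-RSB
Parisi measure has a density with two jumps, of sizes `α` at `a` and `β` at `b = q`. Everything then
rests on the sign of `G` and of its tail integrals `∫_u^1 G`.

Necessity. Stationarity (`IsParisiMeasure.stationary_stepDensity`) gives `W(1) = ξ'(1)`, nonnegative
tail integrals of `G`, and zero tail integrals at the two jumps. Since `ξ'(x)/x` is strictly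
increasing while `W` is linear before the first jump, that jump must sit at `0`. Interior minimality
at `q` gives `G(q) = 0` and `ξ''(q) M² ≤ 1`, where `N`, `M`, `Δ` are the tails of `ν` at `0`, at `q`
and at `1`. With `1 + z₂ = M / Δ`, the two mean-zero conditions on `[0,q]` and `[q,1]` become `f₁ =
f₂ = 0` (`f1_eq_integral`, `f2_eq_integral`), the curvature bound becomes the upper bound on `1 +
z₂`, and `β > 0` becomes the lower bound.

Sufficiency. The data `(q, z₂)` determine `Δ, M, N, α, β`, and minimality has to be certified. By
the tangent line inequality for `1/x` it is enough that `∫ W dν' ≤ ∫ ξ' dν'` for every competitor,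
with equality at `ν` (`isParisiMeasure_of_dual`). Competitors have nondecreasing densities, so this
follows by rearrangement if on each of `[0,q]` and `[q,1]` the mean-zero function `G` changes sign
once, from `-` to `+` (`isParisiMeasure_of_crossing`). After clearing denominators `G` is a
polynomial with few terms, and Rolle-type counting excludes any other sign pattern
(`no_crossing_left`, `no_crossing_right`, both resting on `fourTerm_no_alternation`).

The redundancy of (4) is algebra: after (1), `h₁(1)` and `-h₂(0)` are positive multiples of `z₂ q -
(1 - q) z₁`. -/

lemma exists_deriv_pos_of_lt {f f' : ℝ → ℝ} (hf : ∀ x, HasDerivAt f (f' x) x) {a b : ℝ}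
    (hab : a < b) (h : f a < f b) : ∃ c ∈ Ioo a b, 0 < f' c := by
  obtain ⟨c, hc, hc'⟩ := exists_hasDerivAt_eq_slope f f' hab
    (fun x _ => (hf x).continuousAt.continuousWithinAt) (fun x _ => hf x)
  exact ⟨c, hc, hc' ▸ div_pos (sub_pos.2 h) (sub_pos.2 hab)⟩

lemma exists_deriv_neg_of_lt {f f' : ℝ → ℝ} (hf : ∀ x, HasDerivAt f (f' x) x) {a b : ℝ}
    (hab : a < b) (h : f b < f a) : ∃ c ∈ Ioo a b, f' c < 0 := by
  obtain ⟨c, hc, hc'⟩ := exists_hasDerivAt_eq_slope f f' hab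
    (fun x _ => (hf x).continuousAt.continuousWithinAt) (fun x _ => hf x)
  exact ⟨c, hc, hc' ▸ div_neg_of_neg_of_pos (sub_neg.2 h) (sub_pos.2 hab)⟩

/-- A four-term polynomial with nonpositive leading coefficient cannot have the sign pattern
`-, +, -, +` on the positive half-line. -/
lemma fourTerm_no_alternation (j : ℕ) {c₀ c₁ c₂ c₃ : ℝ} (hc₃ : c₃ ≤ 0) {x₁ x₂ x₃ x₄ : ℝ}
    (h0 : 0 < x₁) (h12 : x₁ < x₂) (h23 : x₂ < x₃) (h34 : x₃ < x₄)
    (hS₁ : c₀ + c₁ * x₁ + c₂ * x₁ ^ (j + 2) + c₃ * x₁ ^ (j + 3) ≤ 0)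
    (hS₂ : 0 < c₀ + c₁ * x₂ + c₂ * x₂ ^ (j + 2) + c₃ * x₂ ^ (j + 3))
    (hS₃ : c₀ + c₁ * x₃ + c₂ * x₃ ^ (j + 2) + c₃ * x₃ ^ (j + 3) ≤ 0)
    (hS₄ : 0 < c₀ + c₁ * x₄ + c₂ * x₄ ^ (j + 2) + c₃ * x₄ ^ (j + 3)) : False := by
  set S : ℝ → ℝ := fun x => c₀ + c₁ * x + c₂ * x ^ (j + 2) + c₃ * x ^ (j + 3) with hS
  set S' : ℝ → ℝ := fun x =>
    c₁ + c₂ * ((j + 2) * x ^ (j + 1)) + c₃ * ((j + 3) * x ^ (j + 2)) with hS'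
  set S'' : ℝ → ℝ := fun x =>
    x ^ j * (c₂ * ((j + 2) * (j + 1)) + c₃ * ((j + 3) * (j + 2)) * x) with hS''
  have d1 : ∀ x, HasDerivAt S (S' x) x := by
    intro x
    have := (((hasDerivAt_id x).const_mul c₁).const_add c₀).add
      ((hasDerivAt_pow (j + 2) x).const_mul c₂) |>.add ((hasDerivAt_pow (j + 3) x).const_mul c₃)
    refine HasDerivAt.congr_deriv this ?_
    simp [hS']
  have d2 : ∀ x, HasDerivAt S' (S'' x) x := by
    intro x
    have := ((((hasDerivAt_pow (j + 1) x).const_mul ((j : ℝ) + 2)).const_mul c₂).const_add c₁).add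
      (((hasDerivAt_pow (j + 2) x).const_mul ((j : ℝ) + 3)).const_mul c₃)
    refine HasDerivAt.congr_deriv this ?_
    simp only [hS'', Nat.add_sub_cancel, show j + 2 - 1 = j + 1 by omega]
    push_cast
    ring
  obtain ⟨y₁, hy₁, hy₁'⟩ := exists_deriv_pos_of_lt d1 h12 (hS₁.trans_lt hS₂)
  obtain ⟨y₂, hy₂, hy₂'⟩ := exists_deriv_neg_of_lt d1 h23 (hS₃.trans_lt hS₂)
  obtain ⟨y₃, hy₃, hy₃'⟩ := exists_deriv_pos_of_lt d1 h34 (hS₃.trans_lt hS₄)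
  -- `S'` has signs `+, -, +`, so `S''` is negative and later positive. But `S''` is `x ^ j` times
  -- an affine function whose slope has the sign of `c₃ ≤ 0`.
  obtain ⟨z₁, hz₁, hz₁'⟩ := exists_deriv_neg_of_lt d2 (hy₁.2.trans hy₂.1) (hy₂'.trans hy₁')
  obtain ⟨z₂, hz₂, hz₂'⟩ := exists_deriv_pos_of_lt d2 (hy₂.2.trans hy₃.1) (hy₂'.trans hy₃')
  have hz₁0 : 0 < z₁ := h0.trans (hy₁.1.trans hz₁.1)
  have hz : z₁ < z₂ := hz₁.2.trans hz₂.1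
  have l1 := (pos_iff_pos_of_mul_pos hz₂').1 (pow_pos (hz₁0.trans hz) j)
  have l2 : c₂ * ((j + 2) * (j + 1)) + c₃ * ((j + 3) * (j + 2)) * z₁ < 0 := by
    by_contra! h
    exact absurd (mul_nonneg (pow_pos hz₁0 j).le h) (not_le.2 hz₁')
  have : c₃ * ((j + 3) * (j + 2)) ≤ 0 := mul_nonpos_of_nonpos_of_nonneg hc₃ (by positivity)
  nlinarith

/-! ### The mixture and its derivatives -/

/-- First derivative of the mixture. -/
def mixtureD (p s : ℕ) (lam x : ℝ) : ℝ :=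
  lam * (p * x ^ (p - 1)) + (1 - lam) * (s * x ^ (s - 1))

/-- Second derivative of the mixture. -/
def mixtureD2 (p s : ℕ) (lam x : ℝ) : ℝ :=
  lam * (p * ((p - 1 : ℕ) * x ^ (p - 2))) + (1 - lam) * (s * ((s - 1 : ℕ) * x ^ (s - 2)))

lemma hasDerivAt_mixture (p s : ℕ) (lam x : ℝ) :
    HasDerivAt (mixture p s lam) (mixtureD p s lam x) x :=
  ((hasDerivAt_pow p x).const_mul lam).add ((hasDerivAt_pow s x).const_mul (1 - lam))

lemma deriv_mixture (p s : ℕ) (lam : ℝ) : deriv (mixture p s lam) = mixtureD p s lam :=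
  funext fun x => (hasDerivAt_mixture p s lam x).deriv

lemma hasDerivAt_mixtureD (p s : ℕ) (lam x : ℝ) :
    HasDerivAt (mixtureD p s lam) (mixtureD2 p s lam x) x :=
  (((hasDerivAt_pow (p - 1) x).const_mul (p : ℝ)).const_mul lam).add
    (((hasDerivAt_pow (s - 1) x).const_mul (s : ℝ)).const_mul (1 - lam))

lemma deriv_mixtureD (p s : ℕ) (lam : ℝ) : deriv (mixtureD p s lam) = mixtureD2 p s lam :=
  funext fun x => (hasDerivAt_mixtureD p s lam x).deriv

lemma continuous_mixtureD (p s : ℕ) (lam : ℝ) : Continuous (mixtureD p s lam) := by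
  unfold mixtureD; fun_prop

lemma mixture_zero {p s : ℕ} (hp : 2 < p) (hs : 2 < s) (lam : ℝ) : mixture p s lam 0 = 0 := by
  simp [mixture, show p ≠ 0 by omega, show s ≠ 0 by omega]

lemma mixture_one (p s : ℕ) (lam : ℝ) : mixture p s lam 1 = 1 := by
  simp [mixture]

lemma mixtureD_zero {p s : ℕ} (hp : 2 < p) (hs : 2 < s) (lam : ℝ) : mixtureD p s lam 0 = 0 := by
  simp [mixtureD, show p - 1 ≠ 0 by omega, show s - 1 ≠ 0 by omega]

/-- A convex combination of two positive reals is positive. -/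
lemma convexComb_pos {lam u v : ℝ} (hlam : lam ∈ Icc (0 : ℝ) 1) (hu : 0 < u) (hv : 0 < v) :
    0 < lam * u + (1 - lam) * v := by
  rcases hlam.1.eq_or_lt with h | h
  · simpa [← h] using hv
  · have := mul_pos h hu
    have := mul_nonneg (sub_nonneg.2 hlam.2) hv.le
    linarith

lemma mixtureD_pos {p s : ℕ} (hp : 2 < p) (hs : 2 < s) {lam : ℝ} (hlam : lam ∈ Icc (0 : ℝ) 1)
    {x : ℝ} (hx : 0 < x) : 0 < mixtureD p s lam x := by
  have : (0 : ℝ) < p := by exact_mod_cast (show 0 < p by omega)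
  have : (0 : ℝ) < s := by exact_mod_cast (show 0 < s by omega)
  exact convexComb_pos hlam (by positivity) (by positivity)

lemma mixtureD2_pos {p s : ℕ} (hp : 2 < p) (hs : 2 < s) {lam : ℝ} (hlam : lam ∈ Icc (0 : ℝ) 1)
    {x : ℝ} (hx : 0 < x) : 0 < mixtureD2 p s lam x := by
  have : (0 : ℝ) < p := by exact_mod_cast (show 0 < p by omega)
  have : (0 : ℝ) < s := by exact_mod_cast (show 0 < s by omega)
  have : (0 : ℝ) < (p - 1 : ℕ) := by exact_mod_cast (show 0 < p - 1 by omega)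
  have : (0 : ℝ) < (s - 1 : ℕ) := by exact_mod_cast (show 0 < s - 1 by omega)
  exact convexComb_pos hlam (by positivity) (by positivity)

/-- Termwise this is `n x^(n-1) < n (n-1) x^(n-1)` for `n ≥ 3`. It turns the curvature bound `ξ''(q)
M² ≤ 1` into `M < N`, that is, into a positive jump at `0`. -/
lemma mixtureD_lt_mul_mixtureD2 {p s : ℕ} (hp : 2 < p) (hs : 2 < s) {lam : ℝ}
    (hlam : lam ∈ Icc (0 : ℝ) 1) {x : ℝ} (hx : 0 < x) :
    mixtureD p s lam x < x * mixtureD2 p s lam x := by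
  have key : ∀ n : ℕ, 2 < n → 0 < x * (n * ((n - 1 : ℕ) * x ^ (n - 2))) - n * x ^ (n - 1) := by
    intro n hn
    obtain ⟨m, rfl⟩ : ∃ m, n = m + 3 := ⟨n - 3, by omega⟩
    have : x * (((m + 3 : ℕ) : ℝ) * ((m + 3 - 1 : ℕ) * x ^ (m + 3 - 2))) -
        (m + 3 : ℕ) * x ^ (m + 3 - 1) = ((m : ℝ) + 3) * (m + 1) * x ^ (m + 2) := by
      simp only [show m + 3 - 2 = m + 1 by omega, show m + 3 - 1 = m + 2 by omega]
      push_cast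
      ring
    rw [this]
    positivity
  have := convexComb_pos hlam (key p hp) (key s hs)
  unfold mixtureD mixtureD2
  linarith

/-- Strict monotonicity of `ξ'(x)/x`, in multiplied-out form. It rules out a density vanishing near
`0`, for which `W` would be linear there. -/
lemma mixtureD_mul_lt {p s : ℕ} (hp : 2 < p) (hs : 2 < s) {lam : ℝ}
    (hlam : lam ∈ Icc (0 : ℝ) 1) {x a : ℝ} (hx : 0 < x) (hxa : x < a) :
    mixtureD p s lam x * a < x * mixtureD p s lam a := by
  have key : ∀ n : ℕ, 2 < n → 0 < x * (n * a ^ (n - 1)) - n * x ^ (n - 1) * a := by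
    intro n hn
    obtain ⟨m, rfl⟩ : ∃ m, n = m + 3 := ⟨n - 3, by omega⟩
    have h : x ^ (m + 1) < a ^ (m + 1) := pow_lt_pow_left₀ hxa hx.le (by omega)
    have : x * (((m + 3 : ℕ) : ℝ) * a ^ (m + 3 - 1)) - (m + 3 : ℕ) * x ^ (m + 3 - 1) * a =
        ((m : ℝ) + 3) * (x * a) * (a ^ (m + 1) - x ^ (m + 1)) := by
      simp only [show m + 3 - 1 = m + 2 by omega]
      push_cast
      ring
    rw [this]
    have := sub_pos.2 h
    have := hx.trans hxa
    positivity
  have := convexComb_pos hlam (key p hp) (key s hs)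
  unfold mixtureD
  linarith

lemma mixtureD_strictMonoOn {p s : ℕ} (hp : 2 < p) (hs : 2 < s) {lam : ℝ}
    (hlam : lam ∈ Icc (0 : ℝ) 1) : StrictMonoOn (mixtureD p s lam) (Ici 0) := by
  refine strictMonoOn_of_deriv_pos (convex_Ici 0) (continuous_mixtureD p s lam).continuousOn ?_
  intro x hx
  rw [interior_Ici] at hx
  rw [deriv_mixtureD]
  exact mixtureD2_pos hp hs hlam hx

/-! ### Single crossing -/

/-- Dividing `ξ'(x)(A - z x) - C x` by `x` leaves a polynomial `P` with a constant term and four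
powers, and `P'` is `x ^ m` times a four-term `S` with exponents `0, 1, j + 2, j + 3`. A change of
`P` from `+` to `-` before its zero `q`, followed by `P 1 > 0`, forces the signs `-, +, +` on `S` at
three points, the last beyond `q`. The slope condition at `q` inserts a nonpositive value between
the two plus signs. -/
lemma no_crossing_left {p s : ℕ} (hp : 2 < p) (hps : p + 1 < s) {lam : ℝ}
    (hlam : lam ∈ Icc (0 : ℝ) 1) {A C z q : ℝ} (hz : 0 ≤ z) (hq1 : q < 1)
    (hq : mixtureD p s lam q * (A - z * q) = C * q)
    (hq' : mixtureD2 p s lam q * (A - z * q) - z * mixtureD p s lam q ≤ C)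
    (h1 : C < mixtureD p s lam 1 * (A - z)) {x y : ℝ} (hx : 0 < x) (hxy : x < y) (hyq : y < q)
    (hPx : C * x < mixtureD p s lam x * (A - z * x))
    (hPy : mixtureD p s lam y * (A - z * y) < C * y) : False := by
  obtain ⟨m, rfl⟩ : ∃ m, p = m + 3 := ⟨p - 3, by omega⟩
  -- The gap `s - p = j + 2 ≥ 2` is where `p + 1 < s` enters: `S''` can then be factored as `x ^ j`
  -- times an affine function.
  obtain ⟨j, rfl⟩ : ∃ j, s = m + j + 5 := ⟨s - m - 5, by omega⟩
  have hy : 0 < y := hx.trans hxy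
  have hq0 : 0 < q := hy.trans hyq
  set a := lam * (m + 3) with ha
  set b := (1 - lam) * (m + j + 5) with hb
  have hb0 : 0 ≤ b := mul_nonneg (sub_nonneg.2 hlam.2) (by positivity)
  set P : ℝ → ℝ := fun x => -C + (a * A * x ^ (m + 1) + -(a * z) * x ^ (m + 2) +
    b * A * x ^ (m + j + 3) + -(b * z) * x ^ (m + j + 4)) with hP
  set S : ℝ → ℝ := fun x => a * A * (m + 1) + -(a * z * (m + 2)) * x +
    b * A * (m + j + 3) * x ^ (j + 2) + -(b * z * (m + j + 4)) * x ^ (j + 3) with hS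
  have hD : ∀ x, mixtureD (m + 3) (m + j + 5) lam x * (A - z * x) - C * x = x * P x := by
    intro x
    simp only [mixtureD, hP, ha, hb, show m + 3 - 1 = m + 2 by omega,
      show m + j + 5 - 1 = m + j + 4 by omega]
    push_cast
    ring
  have dP : ∀ x, HasDerivAt P (x ^ m * S x) x := by
    intro x
    have := ((((hasDerivAt_pow (m + 1) x).const_mul (a * A)).add
      ((hasDerivAt_pow (m + 2) x).const_mul (-(a * z)))).add
      ((hasDerivAt_pow (m + j + 3) x).const_mul (b * A))).add
      ((hasDerivAt_pow (m + j + 4) x).const_mul (-(b * z))) |>.const_add (-C)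
    refine HasDerivAt.congr_deriv this ?_
    simp only [hS, show m + 1 - 1 = m by omega, show m + 2 - 1 = m + 1 by omega,
      show m + j + 3 - 1 = m + j + 2 by omega, show m + j + 4 - 1 = m + j + 3 by omega]
    push_cast
    ring
  have hPx' : 0 < P x := pos_of_mul_pos_right (by rw [← hD]; linarith) hx.le
  have hPy' : P y < 0 := by
    by_contra! h
    have := mul_nonneg hy.le h
    rw [← hD] at this
    linarith
  have hPq : P q = 0 := by
    have := hD q
    rw [hq, sub_self, eq_comm, mul_eq_zero] at this
    exact this.resolve_left hq0.ne'
  have hP1 : 0 < P 1 := by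
    have := hD 1
    rw [one_mul] at this
    rw [← this]
    simpa using h1
  have hSq : S q ≤ 0 := by
    -- The derivative of `x P(x)` at `q` is `P q + q P'(q)`, and `P q = 0`.
    have e : mixtureD2 (m + 3) (m + j + 5) lam q * (A - z * q)
        - z * mixtureD (m + 3) (m + j + 5) lam q - C = P q + q * (q ^ m * S q) := by
      simp only [mixtureD, mixtureD2, hP, hS, ha, hb, show m + 3 - 1 = m + 2 by omega,
        show m + 3 - 2 = m + 1 by omega, show m + j + 5 - 2 = m + j + 3 by omega,
        show m + j + 5 - 1 = m + j + 4 by omega]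
      push_cast
      ring
    rw [hPq, zero_add] at e
    by_contra! h
    have : 0 < q * (q ^ m * S q) := by positivity
    linarith
  have pos_of : ∀ t, 0 < t → 0 < t ^ m * S t → 0 < S t := fun t ht h =>
    pos_of_mul_pos_right h (pow_pos ht m).le
  obtain ⟨t₁, ht₁, h₁⟩ := exists_deriv_neg_of_lt dP hxy (hPy'.trans hPx')
  obtain ⟨t₂, ht₂, h₂⟩ := exists_deriv_pos_of_lt dP hyq (hPq ▸ hPy')
  obtain ⟨t₃, ht₃, h₃⟩ := exists_deriv_pos_of_lt dP hq1 (hPq ▸ hP1)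
  have ht₁0 : 0 < t₁ := hx.trans ht₁.1
  have h₁' : S t₁ ≤ 0 := by
    by_contra! h
    have : 0 < t₁ ^ m * S t₁ := by positivity
    linarith
  exact fourTerm_no_alternation j (c₃ := -(b * z * (m + j + 4)))
    (neg_nonpos.2 (by positivity)) ht₁0 (ht₁.2.trans ht₂.1) ht₂.2
    ht₃.1 h₁' (pos_of t₂ (hy.trans ht₂.1) h₂) hSq (pos_of t₃ (hq0.trans ht₃.1) h₃)

/-- The same counting one derivative later: `H''` is `x ^ m` times a four-term polynomial. The
values of `H` at `0 < q < x < y < 1`, together with `H'(q) ≤ 0`, force `H'` through `+, ≤ 0, +, -,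
+`, hence `H''` through `-, +, -, +`. -/
lemma no_crossing_right {p s : ℕ} (hp : 2 < p) (hps : p + 1 < s) {lam : ℝ}
    (hlam : lam ∈ Icc (0 : ℝ) 1) {B E D z q : ℝ} (hz : 0 ≤ z) (hq0 : 0 < q)
    {H : ℝ → ℝ} (hH : H = fun x => (mixtureD p s lam x - E) * (B - z * x) - (x - q) * D)
    (h0 : H 0 < 0) (hq : H q = 0)
    (hq' : mixtureD2 p s lam q * (B - z * q) - z * (mixtureD p s lam q - E) ≤ D)
    (h1 : H 1 = 0) {x y : ℝ} (hqx : q < x) (hxy : x < y) (hy1 : y < 1)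
    (hHx : 0 < H x) (hHy : H y < 0) : False := by
  obtain ⟨m, rfl⟩ : ∃ m, p = m + 3 := ⟨p - 3, by omega⟩
  obtain ⟨j, rfl⟩ : ∃ j, s = m + j + 5 := ⟨s - m - 5, by omega⟩
  set a := lam * (m + 3) with ha
  set b := (1 - lam) * (m + j + 5) with hb
  have hb0 : 0 ≤ b := mul_nonneg (sub_nonneg.2 hlam.2) (by positivity)
  set H' : ℝ → ℝ := fun x => mixtureD2 (m + 3) (m + j + 5) lam x * (B - z * x)
    - z * (mixtureD (m + 3) (m + j + 5) lam x - E) - D with hH'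
  set S : ℝ → ℝ := fun x => a * B * ((m + 2) * (m + 1)) + -(a * z * ((m + 3) * (m + 2))) * x +
    b * B * ((m + j + 4) * (m + j + 3)) * x ^ (j + 2) +
    -(b * z * ((m + j + 5) * (m + j + 4))) * x ^ (j + 3) with hS
  have d1 : ∀ x, HasDerivAt H (H' x) x := by
    intro x
    have := (((hasDerivAt_mixtureD (m + 3) (m + j + 5) lam x).sub_const E).mul
      (((hasDerivAt_id x).const_mul z).const_sub B)).sub
      (((hasDerivAt_id x).sub_const q).mul_const D)
    rw [hH]
    refine HasDerivAt.congr_deriv this ?_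
    simp only [hH', id]
    ring
  have d2 : ∀ x, HasDerivAt H' (x ^ m * S x) x := by
    intro x
    have e : H' = fun x => (a * B * (m + 2)) * x ^ (m + 1) + (-(a * z * (m + 3))) * x ^ (m + 2) +
        (b * B * (m + j + 4)) * x ^ (m + j + 3) + (-(b * z * (m + j + 5))) * x ^ (m + j + 4)
        + (z * E - D) := by
      funext x
      simp only [mixtureD, mixtureD2, hH', ha, hb, show m + 3 - 1 = m + 2 by omega,
        show m + 3 - 2 = m + 1 by omega, show m + j + 5 - 2 = m + j + 3 by omega,
        show m + j + 5 - 1 = m + j + 4 by omega]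
      push_cast
      ring
    rw [e]
    have := ((((hasDerivAt_pow (m + 1) x).const_mul (a * B * (m + 2))).add
      ((hasDerivAt_pow (m + 2) x).const_mul (-(a * z * (m + 3))))).add
      ((hasDerivAt_pow (m + j + 3) x).const_mul (b * B * (m + j + 4)))).add
      ((hasDerivAt_pow (m + j + 4) x).const_mul (-(b * z * (m + j + 5)))) |>.add_const (z * E - D)
    refine HasDerivAt.congr_deriv this ?_
    simp only [hS, show m + 1 - 1 = m by omega, show m + 2 - 1 = m + 1 by omega,
      show m + j + 3 - 1 = m + j + 2 by omega, show m + j + 4 - 1 = m + j + 3 by omega]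
    push_cast
    ring
  have pos_of : ∀ t, 0 < t → 0 < t ^ m * S t → 0 < S t := fun t ht h =>
    pos_of_mul_pos_right h (pow_pos ht m).le
  have nonpos_of : ∀ t, 0 < t → t ^ m * S t < 0 → S t ≤ 0 := fun t ht h => by
    by_contra! h'
    have : 0 < t ^ m * S t := by positivity
    linarith
  have hH'q : H' q ≤ 0 := by simp only [hH']; linarith
  obtain ⟨t₁, ht₁, h₁⟩ := exists_deriv_pos_of_lt d1 hq0 (hq ▸ h0)
  obtain ⟨t₃, ht₃, h₃⟩ := exists_deriv_pos_of_lt d1 hqx (hq ▸ hHx)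
  obtain ⟨t₄, ht₄, h₄⟩ := exists_deriv_neg_of_lt d1 hxy (hHy.trans hHx)
  obtain ⟨t₅, ht₅, h₅⟩ := exists_deriv_pos_of_lt d1 hy1 (h1 ▸ hHy)
  obtain ⟨u₁, hu₁, k₁⟩ := exists_deriv_neg_of_lt d2 ht₁.2 (hH'q.trans_lt h₁)
  obtain ⟨u₂, hu₂, k₂⟩ := exists_deriv_pos_of_lt d2 ht₃.1 (hH'q.trans_lt h₃)
  obtain ⟨u₃, hu₃, k₃⟩ := exists_deriv_neg_of_lt d2 (ht₃.2.trans ht₄.1) (h₄.trans h₃)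
  obtain ⟨u₄, hu₄, k₄⟩ := exists_deriv_pos_of_lt d2 (ht₄.2.trans ht₅.1) (h₄.trans h₅)
  have p₁ : 0 < u₁ := ht₁.1.trans hu₁.1
  have q₁ : u₁ < u₂ := hu₁.2.trans hu₂.1
  have q₂ : u₂ < u₃ := hu₂.2.trans hu₃.1
  have q₃ : u₃ < u₄ := hu₃.2.trans hu₄.1
  exact fourTerm_no_alternation j (c₃ := -(b * z * ((m + j + 5) * (m + j + 4))))
    (neg_nonpos.2 (by positivity)) p₁ q₁ q₂ q₃ (nonpos_of _ p₁ k₁)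
    (pos_of _ (p₁.trans q₁) k₂) (nonpos_of _ (p₁.trans (q₁.trans q₂)) k₃)
    (pos_of _ (p₁.trans (q₁.trans (q₂.trans q₃))) k₄)

/-- A continuous function with vanishing integral that never passes from positive to negative
changes sign exactly once. -/
lemma exists_crossing_point {G : ℝ → ℝ} (hG : Continuous G) {a b : ℝ} (hab : a < b)
    (hint : ∫ x in a..b, G x = 0)
    (hcross : ∀ x y, a ≤ x → x < y → y ≤ b → 0 < G x → G y < 0 → False) :
    ∃ c ∈ Ico a b, (∀ x ∈ Ico a c, G x ≤ 0) ∧ ∀ x ∈ Ioc c b, 0 ≤ G x := by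
  set N := {x ∈ Icc a b | G x < 0} with hN
  by_cases hne : N.Nonempty
  · have hbdd : BddAbove N := ⟨b, fun x hx => hx.1.2⟩
    obtain ⟨n, hn⟩ := hne
    -- A negative value must be balanced by a positive one. All negative points lie to the left of
    -- that `x₀ < b`, which keeps `c = sSup N` strictly below `b`.
    have hpos : ∃ x₀ ∈ Ico a b, 0 < G x₀ := by
      by_contra! h
      have hle : ∀ x ∈ Icc a b, G x ≤ 0 := by
        intro x hx
        rw [← closure_Ico hab.ne] at hx
        exact closure_minimal (s := Ico a b) (t := {x | G x ≤ 0}) h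
          (isClosed_le hG continuous_const) hx
      have := intervalIntegral.integral_pos (f := fun x => - G x) hab hG.neg.continuousOn
        (fun x hx => neg_nonneg.2 (hle x ⟨hx.1.le, hx.2⟩)) ⟨n, hn.1, neg_pos.2 hn.2⟩
      rw [intervalIntegral.integral_neg, hint] at this
      simp at this
    obtain ⟨x₀, hx₀, hx₀'⟩ := hpos
    refine ⟨sSup N, ⟨hn.1.1.trans (le_csSup hbdd hn), ?_⟩, ?_, ?_⟩
    · refine (csSup_le ⟨n, hn⟩ fun y hy => ?_).trans_lt hx₀.2
      by_contra! h
      exact hcross x₀ y hx₀.1 h hy.1.2 hx₀' hy.2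
    · intro x hx
      obtain ⟨y, hy, hxy⟩ := exists_lt_of_lt_csSup ⟨n, hn⟩ hx.2
      by_contra! h
      exact hcross x y hx.1 hxy hy.1.2 h hy.2
    · intro x hx
      by_contra! h
      have : a ≤ x := (hn.1.1.trans (le_csSup hbdd hn)).trans hx.1.le
      exact absurd (le_csSup hbdd (show x ∈ N from ⟨⟨this, hx.2⟩, h⟩)) (not_le.2 hx.1)
  · refine ⟨a, ⟨le_rfl, hab⟩, by simp, fun x hx => ?_⟩
    by_contra! h
    exact hne ⟨x, ⟨hx.1.le, hx.2⟩, h⟩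

/-! ### Integrals against the order measure -/

/-- A competitor's density need not be integrable near `1`, so the measure may be infinite;
s-finiteness is still enough for Tonelli. -/
instance (γ : ℝ → ℝ) (Δ : ℝ) : SFinite (orderMeasure γ Δ) := by
  unfold orderMeasure; infer_instance

lemma Admissible.aemeasurable {γ : ℝ → ℝ} {Δ : ℝ} (h : Admissible γ Δ) :
    AEMeasurable γ (volume.restrict (Ico (0 : ℝ) 1)) :=
  aemeasurable_restrict_of_monotoneOn measurableSet_Ico h.monotoneOn

lemma orderMeasure_congr {γ γ' : ℝ → ℝ} (h : ∀ x ∈ Ico (0 : ℝ) 1, γ x = γ' x) (Δ : ℝ) :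
    orderMeasure γ Δ = orderMeasure γ' Δ := by
  unfold orderMeasure
  congr 1
  refine withDensity_congr_ae ?_
  filter_upwards [ae_restrict_mem measurableSet_Ico] with x hx
  rw [h x hx]

lemma lintegral_orderMeasure {γ : ℝ → ℝ} (hγ : AEMeasurable γ (volume.restrict (Ico (0 : ℝ) 1)))
    (Δ : ℝ) {f : ℝ → ENNReal} (hf : Measurable f) :
    ∫⁻ x in Icc (0 : ℝ) 1, f x ∂orderMeasure γ Δ =
      (∫⁻ x in Ico (0 : ℝ) 1, f x * ENNReal.ofReal (γ x)) + f 1 * ENNReal.ofReal Δ := by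
  unfold orderMeasure
  rw [Measure.restrict_add, lintegral_add_measure]
  congr 1
  · rw [restrict_withDensity measurableSet_Icc, Measure.restrict_restrict measurableSet_Icc,
      inter_eq_self_of_subset_right Ico_subset_Icc_self,
      lintegral_withDensity_eq_lintegral_mul₀ hγ.ennreal_ofReal hf.aemeasurable]
    simp only [Pi.mul_apply, mul_comm]
  · rw [Measure.restrict_smul, lintegral_smul_measure, restrict_dirac' measurableSet_Icc,
      if_pos (by simp), lintegral_dirac' _ hf, smul_eq_mul, mul_comm]

lemma orderMeasure_Ioc {γ : ℝ → ℝ} (hγ : IntegrableOn γ (Ico 0 1))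
    (h0 : ∀ x ∈ Ico (0 : ℝ) 1, 0 ≤ γ x) {Δ : ℝ} (hΔ : 0 ≤ Δ) {x : ℝ} (hx : x ∈ Ico (0 : ℝ) 1) :
    orderMeasure γ Δ (Ioc x 1) = ENNReal.ofReal (Δ + ∫ t in x..1, γ t) := by
  have hsub : Ioo x 1 ⊆ Ico 0 1 := fun t ht => ⟨hx.1.trans ht.1.le, ht.2⟩
  have hset : Ioc x 1 ∩ Ico 0 1 = Ioo x 1 := by
    ext t
    simp only [mem_inter_iff, mem_Ioc, mem_Ico, mem_Ioo]
    constructor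
    · rintro ⟨h, h'⟩; exact ⟨h.1, h'.2⟩
    · rintro h; exact ⟨⟨h.1, h.2.le⟩, hx.1.trans h.1.le, h.2⟩
  unfold orderMeasure
  rw [Measure.add_apply, withDensity_apply _ measurableSet_Ioc,
    Measure.restrict_restrict measurableSet_Ioc, hset, Measure.smul_apply,
    Measure.dirac_apply' _ measurableSet_Ioc, indicator_of_mem (by simp [hx.2]), Pi.one_apply,
    smul_eq_mul, mul_one, intervalIntegral.integral_of_le hx.2.le, integral_Ioc_eq_integral_Ioo,
    add_comm Δ, ENNReal.ofReal_add _ hΔ, ofReal_integral_eq_lintegral_ofReal (hγ.mono_set hsub)]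
  · filter_upwards [ae_restrict_mem measurableSet_Ioo] with t ht using h0 t (hsub ht)
  · exact setIntegral_nonneg measurableSet_Ioo fun t ht => h0 t (hsub ht)

/-- Tonelli on the region `x < y`. With `f = Φ⁻²` it turns the linearised tail term into `∫ W dν`.
-/
lemma lintegral_mul_tail (ν : Measure ℝ) [SFinite ν] {f : ℝ → ENNReal} (hf : Measurable f) :
    ∫⁻ x in Icc (0 : ℝ) 1, f x * ν (Ioc x 1) =
      ∫⁻ y in Icc (0 : ℝ) 1, (∫⁻ x in Ico 0 y, f x) ∂ν := by
  have h1 : ∀ x ∈ Icc (0 : ℝ) 1, f x * ν (Ioc x 1) =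
      ∫⁻ y in Icc (0 : ℝ) 1, {z : ℝ × ℝ | z.1 < z.2}.indicator (fun z => f z.1) (x, y) ∂ν := by
    intro x hx
    have : ∀ y, {z : ℝ × ℝ | z.1 < z.2}.indicator (fun z => f z.1) (x, y) =
        (Ioi x).indicator (fun _ => f x) y := fun y => rfl
    simp only [this]
    rw [lintegral_indicator measurableSet_Ioi, Measure.restrict_restrict measurableSet_Ioi,
      setLIntegral_const]
    congr 2
    ext y
    simp only [mem_Ioc, mem_inter_iff, mem_Ioi, mem_Icc]
    exact ⟨fun h => ⟨h.1, hx.1.trans h.1.le, h.2⟩, fun h => ⟨h.1, h.2.2⟩⟩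
  have h2 : ∀ y ∈ Icc (0 : ℝ) 1, (∫⁻ x in Ico 0 y, f x) =
      ∫⁻ x in Icc (0 : ℝ) 1, {z : ℝ × ℝ | z.1 < z.2}.indicator (fun z => f z.1) (x, y) := by
    intro y hy
    have : ∀ x, {z : ℝ × ℝ | z.1 < z.2}.indicator (fun z => f z.1) (x, y) =
        (Iio y).indicator f x := fun y => rfl
    simp only [this]
    rw [lintegral_indicator measurableSet_Iio, Measure.restrict_restrict measurableSet_Iio]
    congr 2
    ext x
    simp only [mem_Ico, mem_inter_iff, mem_Iio, mem_Icc]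
    exact ⟨fun h => ⟨h.2, h.1, (h.2.trans_le hy.2).le⟩, fun h => ⟨h.2.1, h.1⟩⟩
  rw [setLIntegral_congr_fun measurableSet_Icc h1, setLIntegral_congr_fun measurableSet_Icc h2]
  refine lintegral_lintegral_swap ?_
  exact ((hf.comp measurable_fst).indicator
    (measurableSet_lt measurable_fst measurable_snd)).aemeasurable

/-- The graph of `1/N` lies above its tangent at `c`; for finite nonzero `N` the difference is `(N -
c)² / (N c²)`. This convexity is what makes the dual certificate sufficient. -/
lemma two_mul_inv_le (N : ENNReal) {c : ℝ} (hc : 0 < c) :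
    2 * ENNReal.ofReal c⁻¹ ≤ N⁻¹ + ENNReal.ofReal (c ^ 2)⁻¹ * N := by
  rcases eq_or_ne N ⊤ with rfl | hN
  · rw [ENNReal.mul_top (by simpa using by positivity)]; simp
  rcases eq_or_ne N 0 with rfl | h0
  · simp
  lift N to NNReal using hN
  have hN0 : 0 < (N : ℝ) := by
    have : N ≠ 0 := by simpa using h0
    exact_mod_cast pos_iff_ne_zero.2 this
  rw [← ENNReal.ofReal_coe_nnreal (p := N), ← ENNReal.ofReal_inv_of_pos hN0,
    ← ENNReal.ofReal_mul (by positivity), ← ENNReal.ofReal_add (by positivity) (by positivity),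
    show (2 : ENNReal) = ENNReal.ofReal 2 by simp, ← ENNReal.ofReal_mul (by norm_num)]
  refine ENNReal.ofReal_le_ofReal ?_
  have : (N : ℝ)⁻¹ + (c ^ 2)⁻¹ * N - 2 * c⁻¹ = ((N : ℝ) - c) ^ 2 / (N * c ^ 2) := by
    field_simp
    ring
  have h : 0 ≤ ((N : ℝ) - c) ^ 2 / (N * c ^ 2) := by positivity
  linarith

/-- A dual certificate of minimality for the Crisanti-Sommers functional: if
`W(y) = ∫₀^y dx / ν((x, 1])²` is dominated in mean by `ξ'` against every order measure, with
equality against `ν`, then `ν` is the Parisi measure. -/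
theorem isParisiMeasure_of_dual {ξ γ Φ : ℝ → ℝ} {Δ : ℝ} (hadm : Admissible γ Δ)
    (hΦ : Continuous Φ) (hpos : ∀ x, 0 < Φ x)
    (htail : ∀ x ∈ Ico (0 : ℝ) 1, orderMeasure γ Δ (Ioc x 1) = ENNReal.ofReal (Φ x))
    (hle : ∀ γ' Δ', Admissible γ' Δ' →
      ∫⁻ y in Icc (0 : ℝ) 1, ENNReal.ofReal (∫ t in (0 : ℝ)..y, (Φ t ^ 2)⁻¹) ∂orderMeasure γ' Δ' ≤
        ∫⁻ y in Icc (0 : ℝ) 1, ENNReal.ofReal (deriv ξ y) ∂orderMeasure γ' Δ')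
    (hge : ∫⁻ y in Icc (0 : ℝ) 1, ENNReal.ofReal (deriv ξ y) ∂orderMeasure γ Δ ≤
      ∫⁻ y in Icc (0 : ℝ) 1, ENNReal.ofReal (∫ t in (0 : ℝ)..y, (Φ t ^ 2)⁻¹) ∂orderMeasure γ Δ) :
    IsParisiMeasure ξ (orderMeasure γ Δ) := by
  have hw : Continuous fun t => (Φ t ^ 2)⁻¹ :=
    (hΦ.pow 2).inv₀ fun x => pow_ne_zero 2 (hpos x).ne'
  have hW : ∀ y ∈ Icc (0 : ℝ) 1, ∫⁻ x in Ico 0 y, ENNReal.ofReal (Φ x ^ 2)⁻¹ =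
      ENNReal.ofReal (∫ t in (0 : ℝ)..y, (Φ t ^ 2)⁻¹) := by
    intro y hy
    rw [intervalIntegral.integral_of_le hy.1, ← restrict_Ico_eq_restrict_Ioc,
      ofReal_integral_eq_lintegral_ofReal]
    · exact hw.integrableOn_Icc.mono_set Ico_subset_Icc_self
    · exact Filter.Eventually.of_forall fun x => by simp only [Pi.zero_apply]; positivity
  have hton : ∀ γ' Δ', ∫⁻ x in Icc (0 : ℝ) 1,
      ENNReal.ofReal (Φ x ^ 2)⁻¹ * orderMeasure γ' Δ' (Ioc x 1) =
      ∫⁻ y in Icc (0 : ℝ) 1, ENNReal.ofReal (∫ t in (0 : ℝ)..y, (Φ t ^ 2)⁻¹)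
        ∂orderMeasure γ' Δ' := by
    intro γ' Δ'
    rw [lintegral_mul_tail _ hw.measurable.ennreal_ofReal]
    exact setLIntegral_congr_fun measurableSet_Icc hW
  set I := ∫⁻ x in Icc (0 : ℝ) 1, ENNReal.ofReal (Φ x)⁻¹ with hI
  have hae : ∀ᵐ x ∂(volume.restrict (Icc (0 : ℝ) 1)), x ∈ Ico (0 : ℝ) 1 := by
    rw [← restrict_Ico_eq_restrict_Icc]
    exact ae_restrict_mem measurableSet_Ico
  refine ⟨⟨γ, Δ, hadm, rfl⟩, ?_⟩
  rintro _ ⟨γ', Δ', hadm', rfl⟩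
  -- At `ν` itself the tangent inequality is an equality, because its tail is `Φ`: both halves of
  -- the functional are bounded by `I = ∫ Φ⁻¹`.
  have hup : crisantiSommers ξ (orderMeasure γ Δ) ≤ 2⁻¹ * (2 * I) := by
    unfold crisantiSommers
    gcongr
    rw [two_mul]
    refine add_le_add (hge.trans_eq ?_) (le_of_eq ?_)
    · rw [← hton]
      refine lintegral_congr_ae ?_
      filter_upwards [hae] with x hx
      rw [htail x hx, ← ENNReal.ofReal_mul (by positivity)]
      congr 1
      have := (hpos x).ne'
      field_simp
    · refine lintegral_congr_ae ?_
      filter_upwards [hae] with x hx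
      rw [htail x hx, ENNReal.ofReal_inv_of_pos (hpos x)]
  refine hup.trans ?_
  unfold crisantiSommers
  gcongr
  calc 2 * I = ∫⁻ x in Icc (0 : ℝ) 1, 2 * ENNReal.ofReal (Φ x)⁻¹ := by
        rw [lintegral_const_mul' _ _ (by simp)]
    _ ≤ ∫⁻ x in Icc (0 : ℝ) 1, ((orderMeasure γ' Δ' (Ioc x 1))⁻¹ +
          ENNReal.ofReal (Φ x ^ 2)⁻¹ * orderMeasure γ' Δ' (Ioc x 1)) :=
        lintegral_mono fun x => two_mul_inv_le _ (hpos x)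
    _ = (∫⁻ x in Icc (0 : ℝ) 1, (orderMeasure γ' Δ' (Ioc x 1))⁻¹) +
          ∫⁻ x in Icc (0 : ℝ) 1,
            ENNReal.ofReal (Φ x ^ 2)⁻¹ * orderMeasure γ' Δ' (Ioc x 1) := by
        refine lintegral_add_left' ?_ _
        refine AEMeasurable.inv (Measurable.aemeasurable ?_)
        refine Antitone.measurable fun x y hxy => measure_mono (Ioc_subset_Ioc_left hxy)
    _ ≤ _ := by
        rw [hton, add_comm]
        exact add_le_add_left (hle γ' Δ' hadm') _

lemma setLIntegral_Ico_ofReal {f : ℝ → ℝ} (hf : Continuous f) {a b : ℝ} (hab : a ≤ b)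
    (h0 : ∀ x ∈ Ico a b, 0 ≤ f x) :
    ∫⁻ x in Ico a b, ENNReal.ofReal (f x) = ENNReal.ofReal (∫ x in a..b, f x) := by
  rw [intervalIntegral.integral_of_le hab, ← restrict_Ico_eq_restrict_Ioc,
    ofReal_integral_eq_lintegral_ofReal]
  · exact hf.integrableOn_Icc.mono_set Ico_subset_Icc_self
  · filter_upwards [ae_restrict_mem measurableSet_Ico] with x hx using h0 x hx

/-- Rearrangement: if `X - W` has vanishing mean on `[a, b]` and changes sign from `-` to `+` at
`c`, then it has nonnegative mean against any nondecreasing weight. -/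
lemma setLIntegral_mul_le_of_crossing {W X γ : ℝ → ℝ} (hW : Continuous W) (hX : Continuous X)
    {a b c : ℝ} (hc : c ∈ Ico a b) (hW0 : ∀ x ∈ Ico a b, 0 ≤ W x) (hX0 : ∀ x ∈ Ico a b, 0 ≤ X x)
    (hγ : MonotoneOn γ (Ico a b)) (hγ0 : ∀ x ∈ Ico a b, 0 ≤ γ x)
    (hint : ∫ x in a..b, W x = ∫ x in a..b, X x)
    (hl : ∀ x ∈ Ico a c, X x ≤ W x) (hr : ∀ x ∈ Ioc c b, W x ≤ X x) :
    ∫⁻ x in Ico a b, ENNReal.ofReal (W x) * ENNReal.ofReal (γ x) ≤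
      ∫⁻ x in Ico a b, ENNReal.ofReal (X x) * ENNReal.ofReal (γ x) := by
  have hab : a ≤ b := hc.1.trans hc.2.le
  -- This is `(X x - W x)(γ x - γ c) ≥ 0`, written without subtraction because the integrals against
  -- `γ` may be infinite. Only the finite term with the constant `γ c` is cancelled at the end.
  have key : ∀ x ∈ Ico a b,
      ENNReal.ofReal (W x) * ENNReal.ofReal (γ x) + ENNReal.ofReal (X x) * ENNReal.ofReal (γ c) ≤
      ENNReal.ofReal (X x) * ENNReal.ofReal (γ x) +
        ENNReal.ofReal (W x) * ENNReal.ofReal (γ c) := by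
    intro x hx
    have h1 := hW0 x hx
    have h2 := hX0 x hx
    have h3 := hγ0 x hx
    have h4 := hγ0 c hc
    rw [← ENNReal.ofReal_mul h1, ← ENNReal.ofReal_mul h2, ← ENNReal.ofReal_mul h1,
      ← ENNReal.ofReal_mul h2, ← ENNReal.ofReal_add (by positivity) (by positivity),
      ← ENNReal.ofReal_add (by positivity) (by positivity)]
    refine ENNReal.ofReal_le_ofReal ?_
    rcases lt_trichotomy x c with h | h | h
    · nlinarith [hl x ⟨hx.1, h⟩, hγ hx hc h.le]
    · subst h; linarith
    · nlinarith [hr x ⟨h, hx.2.le⟩, hγ hc hx h.le]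
  have hI : ∫⁻ x in Ico a b, ENNReal.ofReal (X x) * ENNReal.ofReal (γ c) =
      ∫⁻ x in Ico a b, ENNReal.ofReal (W x) * ENNReal.ofReal (γ c) := by
    rw [lintegral_mul_const' _ _ (by simp), lintegral_mul_const' _ _ (by simp),
      setLIntegral_Ico_ofReal hX hab hX0, setLIntegral_Ico_ofReal hW hab hW0, hint]
  have hfin : ∫⁻ x in Ico a b, ENNReal.ofReal (W x) * ENNReal.ofReal (γ c) ≠ ⊤ := by
    rw [lintegral_mul_const' _ _ (by simp), setLIntegral_Ico_ofReal hW hab hW0]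
    exact ENNReal.mul_ne_top (by simp) (by simp)
  have := setLIntegral_mono_ae' (μ := volume) measurableSet_Ico (Filter.Eventually.of_forall key)
  rw [lintegral_add_right _ (by fun_prop), lintegral_add_right _ (by fun_prop), hI] at this
  exact (ENNReal.add_le_add_iff_right hfin).1 this

/-- Minimality from single crossing: with `W(y) = ∫₀^y dx / ν((x, 1])²`, suppose that
`W(1) = ξ'(1)` and that on each of `[0, q]` and `[q, 1]` the difference `ξ' - W` has mean zero
and passes from `-` to `+`, while `γ` is constant there. -/
theorem isParisiMeasure_of_crossing {ξ γ Φ : ℝ → ℝ} {Δ q m₁ m₂ : ℝ} (hadm : Admissible γ Δ)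
    (hξ : Continuous (deriv ξ)) (hξ0 : ∀ x ∈ Ico (0 : ℝ) 1, 0 ≤ deriv ξ x)
    (hΦ : Continuous Φ) (hpos : ∀ x, 0 < Φ x)
    (htail : ∀ x ∈ Ico (0 : ℝ) 1, orderMeasure γ Δ (Ioc x 1) = ENNReal.ofReal (Φ x))
    (hq : q ∈ Ioo (0 : ℝ) 1) (hm₁ : ∀ x ∈ Ico 0 q, γ x = m₁) (hm₂ : ∀ x ∈ Ico q 1, γ x = m₂)
    (h1 : ∫ t in (0 : ℝ)..1, (Φ t ^ 2)⁻¹ = deriv ξ 1)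
    (hl : ∫ y in (0 : ℝ)..q, (deriv ξ y - ∫ t in (0 : ℝ)..y, (Φ t ^ 2)⁻¹) = 0)
    (hr : ∫ y in q..1, (deriv ξ y - ∫ t in (0 : ℝ)..y, (Φ t ^ 2)⁻¹) = 0)
    (hlc : ∀ x y, 0 ≤ x → x < y → y ≤ q → 0 < deriv ξ x - ∫ t in (0 : ℝ)..x, (Φ t ^ 2)⁻¹ →
      deriv ξ y - ∫ t in (0 : ℝ)..y, (Φ t ^ 2)⁻¹ < 0 → False)
    (hrc : ∀ x y, q ≤ x → x < y → y ≤ 1 → 0 < deriv ξ x - ∫ t in (0 : ℝ)..x, (Φ t ^ 2)⁻¹ →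
      deriv ξ y - ∫ t in (0 : ℝ)..y, (Φ t ^ 2)⁻¹ < 0 → False) :
    IsParisiMeasure ξ (orderMeasure γ Δ) := by
  have hw : Continuous fun t => (Φ t ^ 2)⁻¹ :=
    (hΦ.pow 2).inv₀ fun x => pow_ne_zero 2 (hpos x).ne'
  set W : ℝ → ℝ := fun y => ∫ t in (0 : ℝ)..y, (Φ t ^ 2)⁻¹ with hWdef
  have hW : Continuous W :=
    intervalIntegral.continuous_primitive (fun a b => hw.intervalIntegrable a b) 0
  have hW0 : ∀ x, 0 ≤ x → 0 ≤ W x := fun x hx =>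
    intervalIntegral.integral_nonneg hx fun t _ => by positivity
  have hG : Continuous fun y => deriv ξ y - W y := hξ.sub hW
  obtain ⟨c₁, hc₁, hc₁l, hc₁r⟩ := exists_crossing_point hG hq.1 hl hlc
  obtain ⟨c₂, hc₂, hc₂l, hc₂r⟩ := exists_crossing_point hG hq.2 hr hrc
  have hil : ∫ x in (0 : ℝ)..q, W x = ∫ x in (0 : ℝ)..q, deriv ξ x := by
    rw [intervalIntegral.integral_sub (hξ.intervalIntegrable _ _) (hW.intervalIntegrable _ _)] at hl
    linarith
  have hir : ∫ x in q..1, W x = ∫ x in q..1, deriv ξ x := by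
    rw [intervalIntegral.integral_sub (hξ.intervalIntegrable _ _) (hW.intervalIntegrable _ _)] at hr
    linarith
  have hs1 : Ico 0 q ⊆ Ico (0 : ℝ) 1 := Ico_subset_Ico_right hq.2.le
  have hs2 : Ico q 1 ⊆ Ico (0 : ℝ) 1 := Ico_subset_Ico_left hq.1.le
  have hsplit : ∀ f : ℝ → ENNReal, ∫⁻ x in Ico (0 : ℝ) 1, f x =
      (∫⁻ x in Ico 0 q, f x) + ∫⁻ x in Ico q 1, f x := by
    intro f
    rw [← Ico_union_Ico_eq_Ico hq.1.le hq.2.le, lintegral_union measurableSet_Ico]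
    exact Ico_disjoint_Ico_same
  refine isParisiMeasure_of_dual hadm hΦ hpos htail ?_ ?_
  · intro γ' Δ' hadm'
    rw [lintegral_orderMeasure hadm'.aemeasurable _ hW.measurable.ennreal_ofReal,
      lintegral_orderMeasure hadm'.aemeasurable _ hξ.measurable.ennreal_ofReal]
    refine add_le_add ?_ (by simp only [hWdef, h1]; exact le_rfl)
    rw [hsplit, hsplit]
    refine add_le_add ?_ ?_
    · exact setLIntegral_mul_le_of_crossing hW hξ hc₁ (fun x hx => hW0 x hx.1)
        (fun x hx => hξ0 x (hs1 hx)) (hadm'.monotoneOn.mono hs1)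
        (fun x hx => hadm'.nonneg x (hs1 hx)) hil (fun x hx => sub_nonpos.1 (hc₁l x hx))
        (fun x hx => sub_nonneg.1 (hc₁r x hx))
    · exact setLIntegral_mul_le_of_crossing hW hξ hc₂ (fun x hx => hW0 x (hq.1.le.trans hx.1))
        (fun x hx => hξ0 x (hs2 hx)) (hadm'.monotoneOn.mono hs2)
        (fun x hx => hadm'.nonneg x (hs2 hx)) hir (fun x hx => sub_nonpos.1 (hc₂l x hx))
        (fun x hx => sub_nonneg.1 (hc₂r x hx))
  · rw [lintegral_orderMeasure hadm.aemeasurable _ hW.measurable.ennreal_ofReal,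
      lintegral_orderMeasure hadm.aemeasurable _ hξ.measurable.ennreal_ofReal]
    refine add_le_add ?_ (by simp only [hWdef, h1]; exact le_rfl)
    have hconst : ∀ {a b m : ℝ} (X : ℝ → ℝ), (∀ x ∈ Ico a b, γ x = m) →
        ∫⁻ x in Ico a b, ENNReal.ofReal (X x) * ENNReal.ofReal (γ x) =
        (∫⁻ x in Ico a b, ENNReal.ofReal (X x)) * ENNReal.ofReal m := by
      intro a b m X h
      rw [← lintegral_mul_const' _ _ (by simp)]
      exact setLIntegral_congr_fun measurableSet_Ico fun x hx => by simp only [h x hx]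
    rw [hsplit, hsplit, hconst _ hm₁, hconst _ hm₂, hconst _ hm₁, hconst _ hm₂,
      setLIntegral_Ico_ofReal hW hq.1.le fun x hx => hW0 x hx.1,
      setLIntegral_Ico_ofReal hW hq.2.le fun x hx => hW0 x (hq.1.le.trans hx.1),
      setLIntegral_Ico_ofReal hξ hq.1.le fun x hx => hξ0 x (hs1 hx),
      setLIntegral_Ico_ofReal hξ hq.2.le fun x hx => hξ0 x (hs2 hx), hil, hir]

/-! ### First variation of the functional -/

lemma crisantiSommers_orderMeasure {ξ γ Φ : ℝ → ℝ} {Δ : ℝ} (hadm : Admissible γ Δ)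
    (hγ : IntegrableOn γ (Ico 0 1)) (hξ : Continuous (deriv ξ))
    (hξ0 : ∀ x ∈ Icc (0 : ℝ) 1, 0 ≤ deriv ξ x) (hΦ : Continuous Φ) (hpos : ∀ x, 0 < Φ x)
    (htail : ∀ x ∈ Ico (0 : ℝ) 1, orderMeasure γ Δ (Ioc x 1) = ENNReal.ofReal (Φ x)) :
    0 ≤ (∫ x in (0 : ℝ)..1, deriv ξ x * γ x) + deriv ξ 1 * Δ + (∫ x in (0 : ℝ)..1, (Φ x)⁻¹) ∧
    crisantiSommers ξ (orderMeasure γ Δ) = 2⁻¹ * ENNReal.ofReal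
      ((∫ x in (0 : ℝ)..1, deriv ξ x * γ x) + deriv ξ 1 * Δ + ∫ x in (0 : ℝ)..1, (Φ x)⁻¹) := by
  have hi : Continuous fun x => (Φ x)⁻¹ := hΦ.inv₀ fun x => (hpos x).ne'
  have e1 : ∫⁻ x in Ico (0 : ℝ) 1, ENNReal.ofReal (deriv ξ x) * ENNReal.ofReal (γ x) =
      ENNReal.ofReal (∫ x in (0 : ℝ)..1, deriv ξ x * γ x) := by
    rw [intervalIntegral.integral_of_le zero_le_one, ← restrict_Ico_eq_restrict_Ioc,
      ofReal_integral_eq_lintegral_ofReal]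
    · exact setLIntegral_congr_fun measurableSet_Ico fun x hx =>
        (ENNReal.ofReal_mul (hξ0 x ⟨hx.1, hx.2.le⟩)).symm
    · exact IntegrableOn.continuousOn_mul_of_subset hξ.continuousOn hγ isCompact_Icc
        measurableSet_Ico Ico_subset_Icc_self
    · filter_upwards [ae_restrict_mem measurableSet_Ico] with x hx
        using mul_nonneg (hξ0 x ⟨hx.1, hx.2.le⟩) (hadm.nonneg x hx)
  have e2 : ∫⁻ x in Icc (0 : ℝ) 1, (orderMeasure γ Δ (Ioc x 1))⁻¹ =
      ENNReal.ofReal (∫ x in (0 : ℝ)..1, (Φ x)⁻¹) := by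
    rw [← setLIntegral_Ico_ofReal hi zero_le_one fun x _ => (inv_pos.2 (hpos x)).le,
      ← restrict_Ico_eq_restrict_Icc]
    refine setLIntegral_congr_fun measurableSet_Ico fun x hx => ?_
    simp only [htail x hx, ENNReal.ofReal_inv_of_pos (hpos x)]
  have n1 : 0 ≤ ∫ x in (0 : ℝ)..1, deriv ξ x * γ x := by
    rw [intervalIntegral.integral_of_le zero_le_one, ← restrict_Ico_eq_restrict_Ioc]
    exact setIntegral_nonneg measurableSet_Ico fun x hx =>
      mul_nonneg (hξ0 x ⟨hx.1, hx.2.le⟩) (hadm.nonneg x hx)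
  have n2 : 0 ≤ deriv ξ 1 * Δ := mul_nonneg (hξ0 1 (by simp)) hadm.pos.le
  have n3 : 0 ≤ ∫ x in (0 : ℝ)..1, (Φ x)⁻¹ :=
    intervalIntegral.integral_nonneg zero_le_one fun x _ => (inv_pos.2 (hpos x)).le
  refine ⟨by positivity, ?_⟩
  unfold crisantiSommers
  rw [lintegral_orderMeasure hadm.aemeasurable _ hξ.measurable.ennreal_ofReal, e1, e2,
    ENNReal.ofReal_add (by positivity) n3, ENNReal.ofReal_add n1 n2,
    ENNReal.ofReal_mul (hξ0 1 (by simp))]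

/-- Second-order Taylor bound with a remainder uniform in `c ≥ d`; it replaces differentiation under
the integral sign. -/
lemma inv_add_le {c d ε t : ℝ} (hd : 0 < d) (hc : d ≤ c) (ht : |t| ≤ 1) (hε : 0 ≤ ε)
    (hε' : ε ≤ d / 2) :
    (c + ε * t)⁻¹ ≤ c⁻¹ - ε * (t * (c ^ 2)⁻¹) + ε ^ 2 * (2 / d ^ 3) := by
  obtain ⟨ht1, ht2⟩ := abs_le.1 ht
  have h1 : d / 2 ≤ c + ε * t := by nlinarith
  have hc0 : 0 < c := hd.trans_le hc
  have h2 : 0 < c + ε * t := by linarith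
  have e : (c + ε * t)⁻¹ = c⁻¹ - ε * (t * (c ^ 2)⁻¹) + ε ^ 2 * (t ^ 2 / (c ^ 2 * (c + ε * t))) := by
    field_simp
    ring
  rw [e]
  refine add_le_add le_rfl (mul_le_mul_of_nonneg_left ?_ (sq_nonneg ε))
  calc t ^ 2 / (c ^ 2 * (c + ε * t)) ≤ 1 / (d ^ 2 * (d / 2)) := by
        gcongr
        exact (sq_le_one_iff_abs_le_one t).2 ht
    _ = 2 / d ^ 3 := by field_simp

/-- Comparing `ν` with its perturbation of size `ε` gives `0 ≤ ε L + ε² (2 / Δ³)`, where `L` is the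
linear term. Dividing by `ε` and taking `ε` small gives `0 ≤ L`. -/
theorem IsParisiMeasure.firstVariation {ξ γ Φ η ψ : ℝ → ℝ} {Δ δ ε₀ : ℝ}
    (hmin : IsParisiMeasure ξ (orderMeasure γ Δ))
    (hξ : Continuous (deriv ξ)) (hξ0 : ∀ x ∈ Icc (0 : ℝ) 1, 0 ≤ deriv ξ x)
    (hadm : Admissible γ Δ) (hγ : IntegrableOn γ (Ico 0 1)) (hη : IntegrableOn η (Ico 0 1))
    (hΦ : Continuous Φ) (hψ : Continuous ψ) (hΔΦ : ∀ x, Δ ≤ Φ x) (hψ1 : ∀ x, |ψ x| ≤ 1)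
    (hΦγ : ∀ x ∈ Ico (0 : ℝ) 1, Φ x = Δ + ∫ t in x..1, γ t)
    (hψη : ∀ x ∈ Ico (0 : ℝ) 1, ψ x = δ + ∫ t in x..1, η t) (hε₀ : 0 < ε₀)
    (hadmε : ∀ ε, 0 < ε → ε ≤ ε₀ → Admissible (fun x => γ x + ε * η x) (Δ + ε * δ)) :
    0 ≤ (∫ x in (0 : ℝ)..1, deriv ξ x * η x) + deriv ξ 1 * δ -
      ∫ x in (0 : ℝ)..1, ψ x * (Φ x ^ 2)⁻¹ := by
  have hΔ := hadm.pos
  have hpos : ∀ x, 0 < Φ x := fun x => hΔ.trans_le (hΔΦ x)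
  have hw : Continuous fun t => ψ t * (Φ t ^ 2)⁻¹ :=
    hψ.mul ((hΦ.pow 2).inv₀ fun x => pow_ne_zero 2 (hpos x).ne')
  have hi : Continuous fun x => (Φ x)⁻¹ := hΦ.inv₀ fun x => (hpos x).ne'
  have hii : ∀ {f : ℝ → ℝ}, IntegrableOn f (Ico 0 1) → ∀ x ∈ Ico (0 : ℝ) 1,
      IntervalIntegrable f volume x 1 := by
    intro f hf x hx
    rw [intervalIntegrable_iff_integrableOn_Ico_of_le hx.2.le]
    exact hf.mono_set (Ico_subset_Ico_left hx.1)
  have hξi : ∀ {f : ℝ → ℝ}, IntegrableOn f (Ico 0 1) →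
      IntervalIntegrable (fun x => deriv ξ x * f x) volume 0 1 := by
    intro f hf
    rw [intervalIntegrable_iff_integrableOn_Ico_of_le zero_le_one]
    exact IntegrableOn.continuousOn_mul_of_subset hξ.continuousOn hf isCompact_Icc
      measurableSet_Ico Ico_subset_Icc_self
  set L := (∫ x in (0 : ℝ)..1, deriv ξ x * η x) + deriv ξ 1 * δ -
      ∫ x in (0 : ℝ)..1, ψ x * (Φ x ^ 2)⁻¹ with hL
  have key : ∀ ε, 0 < ε → ε ≤ ε₀ → ε ≤ Δ / 2 → 0 ≤ L + ε * (2 / Δ ^ 3) := by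
    intro ε hε h1 h2
    have hposε : ∀ x, 0 < Φ x + ε * ψ x := by
      intro x
      have := (abs_le.1 (hψ1 x)).1
      nlinarith [hΔΦ x]
    have hΦε : Continuous fun x => Φ x + ε * ψ x := hΦ.add (hψ.const_mul ε)
    have hγε : IntegrableOn (fun x => γ x + ε * η x) (Ico 0 1) := hγ.add (hη.const_mul ε)
    obtain ⟨-, hQ⟩ := crisantiSommers_orderMeasure hadm hγ hξ hξ0 hΦ hpos fun x hx => by
      rw [orderMeasure_Ioc hγ hadm.nonneg hΔ.le hx, hΦγ x hx]
    obtain ⟨hn, hQε⟩ := crisantiSommers_orderMeasure (hadmε ε hε h1) hγε hξ hξ0 hΦε hposε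
      fun x hx => by
        rw [orderMeasure_Ioc hγε (hadmε ε hε h1).nonneg (hadmε ε hε h1).pos.le hx, hΦγ x hx,
          hψη x hx, intervalIntegral.integral_add (hii hγ x hx) ((hii hη x hx).const_mul ε),
          intervalIntegral.integral_const_mul]
        congr 1
        ring
    have hle := hmin.2 _ ⟨_, _, hadmε ε hε h1, rfl⟩
    rw [hQ, hQε, ENNReal.mul_le_mul_iff_right (by simp) (by simp),
      ENNReal.ofReal_le_ofReal_iff hn] at hle
    have e1 : ∫ x in (0 : ℝ)..1, deriv ξ x * (γ x + ε * η x) =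
        (∫ x in (0 : ℝ)..1, deriv ξ x * γ x) + ε * ∫ x in (0 : ℝ)..1, deriv ξ x * η x := by
      rw [← intervalIntegral.integral_const_mul, ← intervalIntegral.integral_add (hξi hγ)
        ((hξi hη).const_mul ε)]
      congr 1
      funext x
      ring
    have e2 : ∫ x in (0 : ℝ)..1, (Φ x + ε * ψ x)⁻¹ ≤ (∫ x in (0 : ℝ)..1, (Φ x)⁻¹) -
        ε * (∫ x in (0 : ℝ)..1, ψ x * (Φ x ^ 2)⁻¹) + ε ^ 2 * (2 / Δ ^ 3) := by
      calc ∫ x in (0 : ℝ)..1, (Φ x + ε * ψ x)⁻¹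
          ≤ ∫ x in (0 : ℝ)..1, ((Φ x)⁻¹ - ε * (ψ x * (Φ x ^ 2)⁻¹) + ε ^ 2 * (2 / Δ ^ 3)) := by
            refine intervalIntegral.integral_mono zero_le_one ?_ ?_ fun x =>
              inv_add_le hΔ (hΔΦ x) (hψ1 x) hε.le h2
            · exact (hΦε.inv₀ fun x => (hposε x).ne').intervalIntegrable _ _
            · exact Continuous.intervalIntegrable (by fun_prop) _ _
        _ = _ := by
            rw [intervalIntegral.integral_add (Continuous.intervalIntegrable (by fun_prop) _ _)
              (by simp), intervalIntegral.integral_sub (hi.intervalIntegrable _ _)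
              ((hw.const_mul ε).intervalIntegrable _ _), intervalIntegral.integral_const_mul]
            simp
    have : 0 ≤ ε * (L + ε * (2 / Δ ^ 3)) := by
      rw [hL]
      rw [e1] at hle
      nlinarith
    exact nonneg_of_mul_nonneg_right this hε
  by_contra! hneg
  have hC : 0 < 2 / Δ ^ 3 := by positivity
  -- The last entry makes the remainder at most `-L / 2`, contradicting `key` when `L < 0`.
  set ε := min (min ε₀ (Δ / 2)) (-L / (2 * (2 / Δ ^ 3))) with hεdef
  have hε : 0 < ε := by
    refine lt_min (lt_min hε₀ (by positivity)) (div_pos (neg_pos.2 hneg) (by positivity))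
  have h1 := key ε hε ((min_le_left _ _).trans (min_le_left _ _))
    ((min_le_left _ _).trans (min_le_right _ _))
  have h2 : ε * (2 / Δ ^ 3) ≤ -L / 2 := by
    calc ε * (2 / Δ ^ 3) ≤ -L / (2 * (2 / Δ ^ 3)) * (2 / Δ ^ 3) := by
          gcongr
          exact min_le_right _ _
      _ = -L / 2 := by field_simp
  linarith

/-! ### Step densities -/

/-- The unit jump at `u`. -/
def jump (u x : ℝ) : ℝ := if u ≤ x then 1 else 0

/-- The tail integral of the unit jump. -/
def cutTail (u x : ℝ) : ℝ := max 0 (1 - max u x)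

lemma continuous_cutTail (u : ℝ) : Continuous (cutTail u) := by
  unfold cutTail; fun_prop

lemma cutTail_nonneg (u x : ℝ) : 0 ≤ cutTail u x := le_max_left _ _

lemma abs_cutTail_le {u : ℝ} (hu : 0 ≤ u) (x : ℝ) : |cutTail u x| ≤ 1 := by
  rw [abs_of_nonneg (cutTail_nonneg u x)]
  exact max_le zero_le_one (by linarith [le_max_left u x])

lemma cutTail_of_le {u x : ℝ} (hu : u ≤ 1) (h : x ≤ u) : cutTail u x = 1 - u := by
  rw [cutTail, max_eq_left h, max_eq_right (sub_nonneg.2 hu)]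

lemma cutTail_of_ge {u x : ℝ} (hx : x ≤ 1) (h : u ≤ x) : cutTail u x = 1 - x := by
  rw [cutTail, max_eq_right h, max_eq_right (sub_nonneg.2 hx)]

lemma jump_nonneg (u x : ℝ) : 0 ≤ jump u x := by
  unfold jump; split_ifs <;> norm_num

lemma jump_mono (u : ℝ) : Monotone (jump u) := by
  intro x y hxy
  unfold jump
  split_ifs with h1 h2 
  · norm_num
  · exact absurd (h1.trans hxy) h2
  · norm_num
  · norm_num

lemma jump_rightContinuous (u x : ℝ) : ContinuousWithinAt (jump u) (Ici x) x := by
  rcases le_or_gt u x with h | h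
  · have : ∀ y ∈ Ici x, jump u y = 1 := fun y hy => if_pos (h.trans hy)
    exact continuousWithinAt_const.congr this (this x self_mem_Ici)
  · refine ContinuousAt.continuousWithinAt ?_
    refine (continuousAt_const (y := (0 : ℝ))).congr ?_
    filter_upwards [Iio_mem_nhds h] with y hy
    exact (if_neg (not_le.2 hy)).symm

lemma integrableOn_jump (u : ℝ) : IntegrableOn (jump u) (Ico 0 1) :=
  ((jump_mono u).monotoneOn _).integrableOn_isCompact isCompact_Icc |>.mono_set Ico_subset_Icc_self

lemma integral_mul_jump (f : ℝ → ℝ) {u x : ℝ} (hu : u ≤ 1) (hx : x ≤ 1) :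
    ∫ t in x..1, f t * jump u t = ∫ t in (max u x)..1, f t := by
  have : (fun t => f t * jump u t) = (Ici u).indicator f := by
    funext t
    by_cases h : u ≤ t <;> simp [jump, h]
  rw [this, intervalIntegral.integral_of_le hx, intervalIntegral.integral_of_le (max_le hu hx),
    ← integral_Ico_eq_integral_Ioc, ← integral_Ico_eq_integral_Ioc,
    setIntegral_indicator measurableSet_Ici]
  congr 2
  ext t
  simp only [mem_inter_iff, mem_Ico, mem_Ici, max_le_iff]
  tauto

lemma integral_jump {u x : ℝ} (hu : u ≤ 1) (hx : x ≤ 1) :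
    ∫ t in x..1, jump u t = cutTail u x := by
  have := integral_mul_jump (fun _ => 1) hu hx
  simp only [one_mul] at this
  rw [this, integral_one, cutTail, max_eq_right (sub_nonneg.2 (max_le hu hx))]

/-- The density with jumps of sizes `α` at `a` and `β` at `b`. -/
def stepDensity (a b α β x : ℝ) : ℝ := α * jump a x + β * jump b x

/-- The tail `x ↦ ν((x, 1])` of the order measure with step density. -/
def stepTail (a b α β Δ x : ℝ) : ℝ := Δ + (α * cutTail a x + β * cutTail b x)

lemma Admissible.add_jump {γ : ℝ → ℝ} {Δ : ℝ} (h : Admissible γ Δ) {ε : ℝ} (hε : 0 ≤ ε) (u : ℝ) :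
    Admissible (fun x => γ x + ε * jump u x) Δ where
  nonneg x hx := add_nonneg (h.nonneg x hx) (mul_nonneg hε (jump_nonneg u x))
  monotoneOn _ hx _ hy hxy :=
    add_le_add (h.monotoneOn hx hy hxy) (mul_le_mul_of_nonneg_left (jump_mono u hxy) hε)
  rightContinuous x hx := (h.rightContinuous x hx).add
    (continuousWithinAt_const.mul (jump_rightContinuous u x))
  pos := h.pos

lemma admissible_stepDensity {a b α β Δ : ℝ} (hα : 0 ≤ α) (hβ : 0 ≤ β) (hΔ : 0 < Δ) :
    Admissible (stepDensity a b α β) Δ := by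
  have h0 : Admissible (fun _ => 0) Δ :=
    ⟨fun _ _ => le_rfl, monotoneOn_const, fun _ _ => continuousWithinAt_const, hΔ⟩
  have := (h0.add_jump hα a).add_jump hβ b
  simp only [zero_add] at this
  exact this

lemma integrableOn_stepDensity (a b α β : ℝ) : IntegrableOn (stepDensity a b α β) (Ico 0 1) :=
  ((integrableOn_jump a).const_mul α).add ((integrableOn_jump b).const_mul β)

lemma continuous_stepTail (a b α β Δ : ℝ) : Continuous (stepTail a b α β Δ) :=
  continuous_const.add (((continuous_cutTail a).const_mul α).add
    ((continuous_cutTail b).const_mul β))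

/-- The truncation in `cutTail` makes this hold on all of `ℝ`, so `stepTail` can be inverted
globally without leaving the continuous functions. -/
lemma le_stepTail {a b α β : ℝ} (Δ : ℝ) (hα : 0 ≤ α) (hβ : 0 ≤ β) (x : ℝ) :
    Δ ≤ stepTail a b α β Δ x :=
  le_add_of_nonneg_right (add_nonneg (mul_nonneg hα (cutTail_nonneg a x))
    (mul_nonneg hβ (cutTail_nonneg b x)))

lemma stepTail_eq {a b : ℝ} (ha : a ≤ 1) (hb : b ≤ 1) (α β Δ : ℝ) {x : ℝ}
    (hx : x ∈ Ico (0 : ℝ) 1) :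
    stepTail a b α β Δ x = Δ + ∫ t in x..1, stepDensity a b α β t := by
  have hi : ∀ u, IntervalIntegrable (jump u) volume x 1 := fun u =>
    (jump_mono u).intervalIntegrable
  unfold stepTail stepDensity
  rw [intervalIntegral.integral_add ((hi a).const_mul α) ((hi b).const_mul β),
    intervalIntegral.integral_const_mul, intervalIntegral.integral_const_mul,
    integral_jump ha hx.2.le, integral_jump hb hx.2.le]

/-- `W(y) = ∫₀^y dx / ν((x, 1])²` for a step density. -/
def stepDual (a b α β Δ y : ℝ) : ℝ := ∫ t in (0 : ℝ)..y, (stepTail a b α β Δ t ^ 2)⁻¹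

lemma continuous_inv_sq_stepTail (a b : ℝ) {α β Δ : ℝ} (hα : 0 ≤ α) (hβ : 0 ≤ β) (hΔ : 0 < Δ) :
    Continuous fun t => (stepTail a b α β Δ t ^ 2)⁻¹ :=
  ((continuous_stepTail a b α β Δ).pow 2).inv₀ fun x =>
    pow_ne_zero 2 (hΔ.trans_le (le_stepTail Δ hα hβ x)).ne'

lemma hasDerivAt_stepDual (a b : ℝ) {α β Δ : ℝ} (hα : 0 ≤ α) (hβ : 0 ≤ β) (hΔ : 0 < Δ) (y : ℝ) :
    HasDerivAt (stepDual a b α β Δ) (stepTail a b α β Δ y ^ 2)⁻¹ y :=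
  (continuous_inv_sq_stepTail a b hα hβ hΔ).integral_hasStrictDerivAt 0 y |>.hasDerivAt

lemma continuous_stepDual (a b : ℝ) {α β Δ : ℝ} (hα : 0 ≤ α) (hβ : 0 ≤ β) (hΔ : 0 < Δ) :
    Continuous (stepDual a b α β Δ) :=
  continuous_iff_continuousAt.2 fun y => (hasDerivAt_stepDual a b hα hβ hΔ y).continuousAt

/-- Integration by parts: the tail is the constant `1 - u` on `[0, u]`, and its contribution cancels
the boundary term from `[u, 1]`. -/
lemma integral_cutTail_mul (a b : ℝ) {α β Δ u : ℝ} (hα : 0 ≤ α) (hβ : 0 ≤ β) (hΔ : 0 < Δ)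
    (hu : u ∈ Icc (0 : ℝ) 1) :
    ∫ x in (0 : ℝ)..1, cutTail u x * (stepTail a b α β Δ x ^ 2)⁻¹ =
      ∫ x in u..1, stepDual a b α β Δ x := by
  have hw := continuous_inv_sq_stepTail a b hα hβ hΔ
  have hcw : Continuous fun x => cutTail u x * (stepTail a b α β Δ x ^ 2)⁻¹ :=
    (continuous_cutTail u).mul hw
  rw [← intervalIntegral.integral_add_adjacent_intervals (b := u)
    (hcw.intervalIntegrable _ _) (hcw.intervalIntegrable _ _)]
  have e1 : ∫ x in (0 : ℝ)..u, cutTail u x * (stepTail a b α β Δ x ^ 2)⁻¹ =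
      (1 - u) * stepDual a b α β Δ u := by
    unfold stepDual
    rw [← intervalIntegral.integral_const_mul]
    refine intervalIntegral.integral_congr fun x hx => ?_
    rw [uIcc_of_le hu.1] at hx
    simp only [cutTail_of_le hu.2 hx.2]
  have e2 : ∫ x in u..1, cutTail u x * (stepTail a b α β Δ x ^ 2)⁻¹ =
      ∫ x in u..1, (1 - x) * (stepTail a b α β Δ x ^ 2)⁻¹ := by
    refine intervalIntegral.integral_congr fun x hx => ?_
    rw [uIcc_of_le hu.2] at hx
    simp only [cutTail_of_ge hx.2 hx.1]
  rw [e1, e2, intervalIntegral.integral_mul_deriv_eq_deriv_mul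
    (u := fun x => 1 - x) (u' := fun _ => -1)
    (v := stepDual a b α β Δ)
    (fun x _ => (hasDerivAt_id x).const_sub 1) (fun x _ => hasDerivAt_stepDual a b hα hβ hΔ x)
    (by simp) (hw.intervalIntegrable _ _)]
  simp

/-- The stationarity conditions at a step density which is the Parisi measure. -/
theorem IsParisiMeasure.stationary_stepDensity {ξ : ℝ → ℝ} {a b α β Δ : ℝ}
    (hξ : Continuous (deriv ξ)) (hξ0 : ∀ x ∈ Icc (0 : ℝ) 1, 0 ≤ deriv ξ x)
    (ha : a ∈ Ico (0 : ℝ) 1) (hb : b ∈ Ico (0 : ℝ) 1) (hα : 0 < α) (hβ : 0 < β) (hΔ : 0 < Δ)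
    (hmin : IsParisiMeasure ξ (orderMeasure (stepDensity a b α β) Δ)) :
    stepDual a b α β Δ 1 = deriv ξ 1 ∧
    (∀ u ∈ Ico (0 : ℝ) 1, 0 ≤ ∫ x in u..1, (deriv ξ x - stepDual a b α β Δ x)) ∧
    ∫ x in a..1, (deriv ξ x - stepDual a b α β Δ x) = 0 ∧
    ∫ x in b..1, (deriv ξ x - stepDual a b α β Δ x) = 0 := by
  have hadm : Admissible (stepDensity a b α β) Δ := admissible_stepDensity hα.le hβ.le hΔ
  have hW := continuous_stepDual a b hα.le hβ.le hΔ
  have dirΔ : ∀ δ : ℝ, |δ| ≤ 1 → 0 ≤ deriv ξ 1 * δ - δ * stepDual a b α β Δ 1 := by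
    intro δ hδ
    have := hmin.firstVariation (η := fun _ => 0) (ψ := fun _ => δ) (δ := δ) (ε₀ := Δ / 2) hξ hξ0
      hadm (integrableOn_stepDensity a b α β) integrableOn_zero (continuous_stepTail a b α β Δ)
      continuous_const (le_stepTail Δ hα.le hβ.le) (fun _ => hδ)
      (fun x hx => stepTail_eq ha.2.le hb.2.le α β Δ hx) (by simp) (by positivity)
      (fun ε hε hε' => by
        simp only [mul_zero, add_zero]
        refine admissible_stepDensity hα.le hβ.le ?_
        nlinarith [(abs_le.1 hδ).1])
    simpa [stepDual] using this
  -- Adding a jump (`c = 1`) is allowed at every `u`. Removing one (`c = -1`) is allowed only where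
  -- there is mass, at `a` up to `α` and at `b` up to `β`; there the inequality becomes an equality.
  have dirJump : ∀ u ∈ Ico (0 : ℝ) 1, ∀ c : ℝ, |c| ≤ 1 → (∃ ε₀ > 0, ∀ ε, 0 < ε → ε ≤ ε₀ →
      Admissible (fun x => stepDensity a b α β x + ε * (c * jump u x)) Δ) →
      0 ≤ c * ∫ x in u..1, (deriv ξ x - stepDual a b α β Δ x) := by
    rintro u hu c hc ⟨ε₀, hε₀, h⟩
    have := hmin.firstVariation (η := fun x => c * jump u x) (ψ := fun x => c * cutTail u x)
      (δ := 0) (ε₀ := ε₀) hξ hξ0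
      hadm (integrableOn_stepDensity a b α β) ((integrableOn_jump u).const_mul c)
      (continuous_stepTail a b α β Δ) ((continuous_cutTail u).const_mul c)
      (le_stepTail Δ hα.le hβ.le)
      (fun x => by
        rw [abs_mul]
        exact mul_le_one₀ hc (abs_nonneg _) (abs_cutTail_le hu.1 x))
      (fun x hx => stepTail_eq ha.2.le hb.2.le α β Δ hx)
      (fun x hx => by
        rw [intervalIntegral.integral_const_mul, integral_jump hu.2.le hx.2.le, zero_add])
      hε₀ (fun ε hε hε' => by simpa using h ε hε hε')
    simp only [mul_left_comm _ c, mul_assoc c] at this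
    rw [intervalIntegral.integral_const_mul, intervalIntegral.integral_const_mul,
      integral_mul_jump _ hu.2.le zero_le_one, max_eq_left hu.1,
      integral_cutTail_mul a b hα.le hβ.le hΔ ⟨hu.1, hu.2.le⟩] at this
    rw [intervalIntegral.integral_sub (hξ.intervalIntegrable _ _) (hW.intervalIntegrable _ _)]
    linarith
  have hnonneg : ∀ u ∈ Ico (0 : ℝ) 1, 0 ≤ ∫ x in u..1, (deriv ξ x - stepDual a b α β Δ x) := by
    intro u hu
    have := dirJump u hu 1 (by simp) ⟨1, one_pos, fun ε hε _ => by
      simpa using hadm.add_jump hε.le u⟩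
    simpa using this
  refine ⟨?_, hnonneg, le_antisymm ?_ (hnonneg a ha), le_antisymm ?_ (hnonneg b hb)⟩
  · have h1 := dirΔ 1 (by simp)
    have h2 := dirΔ (-1) (by simp)
    linarith
  · have := dirJump a ha (-1) (by simp) ⟨α, hα, fun ε hε hε' => by
      convert admissible_stepDensity (a := a) (b := b) (sub_nonneg.2 hε') hβ.le hΔ using 1
      funext x
      simp only [stepDensity]
      ring⟩
    linarith
  · have := dirJump b hb (-1) (by simp) ⟨β, hβ, fun ε hε hε' => by
      convert admissible_stepDensity (a := a) (b := b) hα.le (sub_nonneg.2 hε') hΔ using 1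
      funext x
      simp only [stepDensity]
      ring⟩
    linarith

/-! ### Explicit integrals for the two-step density -/

lemma integral_inv_sq_affine {a y c m : ℝ} (hay : a ≤ y) (hc : 0 < c) (hm : 0 ≤ m)
    (hy : 0 < c - m * (y - a)) :
    ∫ t in a..y, ((c - m * (t - a)) ^ 2)⁻¹ = (y - a) / (c * (c - m * (y - a))) := by
  have hpos : ∀ t ∈ uIcc a y, c - m * (t - a) ≠ 0 := by
    intro t ht
    rw [uIcc_of_le hay] at ht
    nlinarith [mul_le_mul_of_nonneg_left ht.2 hm]
  have hd : ∀ t ∈ uIcc a y, HasDerivAt (fun t => (t - a) / (c * (c - m * (t - a))))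
      ((c - m * (t - a)) ^ 2)⁻¹ t := by
    intro t ht
    have h := hpos t ht
    have h1 : HasDerivAt (fun t => t - a) 1 t := (hasDerivAt_id t).sub_const a
    refine (h1.div (((h1.const_mul m).const_sub c).const_mul c)
      (mul_ne_zero hc.ne' h)).congr_deriv ?_
    field_simp
    ring
  rw [intervalIntegral.integral_eq_sub_of_hasDerivAt hd]
  · simp
  · refine ContinuousOn.intervalIntegrable ?_
    exact ContinuousOn.inv₀ (by fun_prop) fun t ht => pow_ne_zero 2 (hpos t ht)

lemma integral_div_affine {a b c m : ℝ} (hab : a ≤ b) (hc : 0 < c) (hm : 0 < m)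
    (hb : 0 < c - m * (b - a)) :
    ∫ y in a..b, (y - a) / (c * (c - m * (y - a))) =
      (-(b - a) + c / m * Real.log (c / (c - m * (b - a)))) / (c * m) := by
  have hpos : ∀ t ∈ uIcc a b, 0 < c - m * (t - a) := by
    intro t ht
    rw [uIcc_of_le hab] at ht
    nlinarith [mul_le_mul_of_nonneg_left ht.2 hm.le]
  have hd : ∀ t ∈ uIcc a b, HasDerivAt
      (fun t => (-(t - a) - c / m * Real.log (c - m * (t - a))) / (c * m))
      ((t - a) / (c * (c - m * (t - a)))) t := by
    intro t ht
    have h := (hpos t ht).ne'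
    have h1 : HasDerivAt (fun t => t - a) 1 t := (hasDerivAt_id t).sub_const a
    refine ((h1.neg.sub ((((h1.const_mul m).const_sub c).log h).const_mul (c / m))).div_const
      (c * m)).congr_deriv ?_
    field_simp
    ring
  rw [intervalIntegral.integral_eq_sub_of_hasDerivAt hd, Real.log_div hc.ne' hb.ne']
  · field_simp
    simp
    ring
  · refine ContinuousOn.intervalIntegrable ?_
    exact ContinuousOn.div (by fun_prop) (by fun_prop)
      fun t ht => mul_ne_zero hc.ne' (hpos t ht).ne'

section TwoStep

variable {q α β Δ M N : ℝ}

lemma stepTail_left (hq : q ∈ Ioo (0 : ℝ) 1) (hM : M = Δ + (α + β) * (1 - q))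
    (hN : N = M + α * q) {x : ℝ} (hx : x ∈ Icc 0 q) :
    stepTail 0 q α β Δ x = N - α * (x - 0) := by
  rw [stepTail, cutTail_of_ge (hx.2.trans hq.2.le) hx.1, cutTail_of_le hq.2.le hx.2, hN, hM]
  ring

lemma stepTail_right (hq : q ∈ Ioo (0 : ℝ) 1) (hM : M = Δ + (α + β) * (1 - q))
    {x : ℝ} (hx : x ∈ Icc q 1) :
    stepTail 0 q α β Δ x = M - (α + β) * (x - q) := by
  rw [stepTail, cutTail_of_ge hx.2 (hq.1.le.trans hx.1), cutTail_of_ge hx.2 hx.1, hM]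
  ring

lemma stepDual_left (hq : q ∈ Ioo (0 : ℝ) 1) (hα : 0 < α) (hMpos : 0 < M)
    (hM : M = Δ + (α + β) * (1 - q)) (hN : N = M + α * q) {x : ℝ} (hx : x ∈ Icc 0 q) :
    stepDual 0 q α β Δ x = (x - 0) / (N * (N - α * (x - 0))) := by
  have hNpos : 0 < N := by rw [hN]; have := mul_pos hα hq.1; linarith
  rw [stepDual, ← integral_inv_sq_affine hx.1 hNpos hα.le]
  · refine intervalIntegral.integral_congr fun t ht => ?_
    rw [uIcc_of_le hx.1] at ht
    simp only [stepTail_left hq hM hN ⟨ht.1, ht.2.trans hx.2⟩]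
  · rw [hN]
    nlinarith [mul_le_mul_of_nonneg_left hx.2 hα.le]

lemma stepDual_at (hq : q ∈ Ioo (0 : ℝ) 1) (hα : 0 < α) (hMpos : 0 < M)
    (hM : M = Δ + (α + β) * (1 - q)) (hN : N = M + α * q) :
    stepDual 0 q α β Δ q = q / (N * M) := by
  rw [stepDual_left hq hα hMpos hM hN ⟨hq.1.le, le_rfl⟩, sub_zero, hN, add_sub_cancel_right]

lemma stepDual_right (hq : q ∈ Ioo (0 : ℝ) 1) (hα : 0 < α) (hβ : 0 < β) (hΔ : 0 < Δ)
    (hMpos : 0 < M) (hM : M = Δ + (α + β) * (1 - q)) {x : ℝ} (hx : x ∈ Icc q 1) :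
    stepDual 0 q α β Δ x =
      stepDual 0 q α β Δ q + (x - q) / (M * (M - (α + β) * (x - q))) := by
  have hw := continuous_inv_sq_stepTail 0 q hα.le hβ.le hΔ
  rw [stepDual, stepDual, ← intervalIntegral.integral_add_adjacent_intervals (b := q)
    (hw.intervalIntegrable _ _) (hw.intervalIntegrable _ _),
    ← integral_inv_sq_affine hx.1 hMpos (add_pos hα hβ).le]
  · congr 1
    refine intervalIntegral.integral_congr fun t ht => ?_
    rw [uIcc_of_le hx.1] at ht
    simp only [stepTail_right hq hM ⟨ht.1, ht.2.trans hx.2⟩]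
  · rw [hM]
    nlinarith [mul_le_mul_of_nonneg_left hx.2 (add_pos hα hβ).le]

lemma stepDual_one (hq : q ∈ Ioo (0 : ℝ) 1) (hα : 0 < α) (hβ : 0 < β) (hΔ : 0 < Δ)
    (hMpos : 0 < M) (hM : M = Δ + (α + β) * (1 - q)) :
    stepDual 0 q α β Δ 1 = stepDual 0 q α β Δ q + (1 - q) / (M * Δ) := by
  rw [stepDual_right hq hα hβ hΔ hMpos hM ⟨hq.2.le, le_rfl⟩]
  congr 3
  rw [hM, add_sub_cancel_right]

variable {ξ : ℝ → ℝ}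

/-- `f₁` is a multiple of the mean of `ξ' - W` over `[0, q]`. -/
lemma f1_eq_integral (hd : ∀ x, HasDerivAt ξ (deriv ξ x) x) (hξ : Continuous (deriv ξ))
    (hξ0 : ξ 0 = 0) (hq : q ∈ Ioo (0 : ℝ) 1) (hα : 0 < α) (hβ : 0 < β) (hΔ : 0 < Δ)
    (hMpos : 0 < M) (hM : M = Δ + (α + β) * (1 - q)) (hN : N = M + α * q)
    (hX : deriv ξ q = q / (N * M)) (hD : deriv ξ 1 - deriv ξ q = (1 - q) / (M * Δ)) :
    f1 ξ q (M / Δ - 1) =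
      (N - M) ^ 2 * ∫ x in (0 : ℝ)..q, (deriv ξ x - stepDual 0 q α β Δ x) := by
  have hNM : N - α * (q - 0) = M := by rw [hN]; ring
  have hNpos : 0 < N := by rw [hN]; have := mul_pos hα hq.1; linarith
  have hW := continuous_stepDual 0 q hα.le hβ.le hΔ
  rw [intervalIntegral.integral_sub (hξ.intervalIntegrable _ _) (hW.intervalIntegrable _ _),
    intervalIntegral.integral_eq_sub_of_hasDerivAt (fun x _ => hd x)
      (hξ.intervalIntegrable _ _), hξ0]
  have e : ∫ x in (0 : ℝ)..q, stepDual 0 q α β Δ x =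
      ∫ x in (0 : ℝ)..q, (x - 0) / (N * (N - α * (x - 0))) := by
    refine intervalIntegral.integral_congr fun t ht => ?_
    rw [uIcc_of_le hq.1.le] at ht
    exact stepDual_left hq hα hMpos hM hN ht
  have hq0 := hq.1.ne'
  have hq1 : 1 - q ≠ 0 := (sub_pos.2 hq.2).ne'
  have hM0 := hMpos.ne'
  have hN0 := hNpos.ne'
  have hΔ0 := hΔ.ne'
  rw [e, integral_div_affine hq.1.le hNpos hα (by rw [hNM]; exact hMpos), hNM]
  have hlog : q * (deriv ξ 1 - deriv ξ q) / ((1 + (M / Δ - 1)) * deriv ξ q * (1 - q)) = N / M := by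
    rw [hD, hX, show 1 + (M / Δ - 1) = M / Δ by ring]
    field_simp
  rw [f1, hlog, hD, hX, show 1 + (M / Δ - 1) = M / Δ by ring, show N - M = α * q by rw [hN]; ring]
  -- With the logarithm treated as an unknown, the claim is a rational identity in the parameters.
  generalize Real.log (N / M) = l
  field_simp
  rw [hN]
  ring

/-- `f₂` is the negative of the mean of `ξ' - W` over `[q, 1]`. -/
lemma f2_eq_integral (hd : ∀ x, HasDerivAt ξ (deriv ξ x) x) (hξ : Continuous (deriv ξ))
    (hξ1 : ξ 1 = 1) (hq : q ∈ Ioo (0 : ℝ) 1) (hα : 0 < α) (hβ : 0 < β) (hΔ : 0 < Δ)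
    (hMpos : 0 < M) (hM : M = Δ + (α + β) * (1 - q)) (hN : N = M + α * q)
    (hX : deriv ξ q = q / (N * M)) (hD : deriv ξ 1 - deriv ξ q = (1 - q) / (M * Δ)) :
    f2 ξ q (M / Δ - 1) = -∫ x in q..1, (deriv ξ x - stepDual 0 q α β Δ x) := by
  have hMΔ : M - (α + β) * (1 - q) = Δ := by rw [hM]; ring
  have hW := continuous_stepDual 0 q hα.le hβ.le hΔ
  have hW' : IntervalIntegrable (fun x => (x - q) / (M * (M - (α + β) * (x - q))))
      volume q 1 := by
    refine ContinuousOn.intervalIntegrable ?_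
    refine ContinuousOn.div (by fun_prop) (by fun_prop) fun t ht => mul_ne_zero hMpos.ne' ?_
    rw [uIcc_of_le hq.2.le] at ht
    nlinarith [mul_le_mul_of_nonneg_left ht.2 (add_pos hα hβ).le]
  rw [intervalIntegral.integral_sub (hξ.intervalIntegrable _ _) (hW.intervalIntegrable _ _),
    intervalIntegral.integral_eq_sub_of_hasDerivAt (fun x _ => hd x)
      (hξ.intervalIntegrable _ _), hξ1]
  have e : ∫ x in q..1, stepDual 0 q α β Δ x =
      ∫ x in q..1, (deriv ξ q + (x - q) / (M * (M - (α + β) * (x - q)))) := by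
    refine intervalIntegral.integral_congr fun t ht => ?_
    rw [uIcc_of_le hq.2.le] at ht
    simp only [stepDual_right hq hα hβ hΔ hMpos hM ht, stepDual_at hq hα hMpos hM hN, hX]
  have hq1 : 1 - q ≠ 0 := (sub_pos.2 hq.2).ne'
  have hM0 := hMpos.ne'
  have hΔ0 := hΔ.ne'
  have hs0 := (add_pos hα hβ).ne'
  rw [e, intervalIntegral.integral_add (by simp) hW', intervalIntegral.integral_const,
    integral_div_affine hq.2.le hMpos (add_pos hα hβ) (by rw [hMΔ]; exact hΔ), hMΔ, smul_eq_mul,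
    f2, show 1 + (M / Δ - 1) = M / Δ by ring, hD,
    -- This form of `z₂` exhibits it as a product of nonzero factors, as needed to clear the
    -- denominators of `f₂`.
    show M / Δ - 1 = (α + β) * (1 - q) / Δ by rw [hM]; field_simp; ring]
  generalize Real.log (M / Δ) = l
  field_simp
  ring

end TwoStep

/-! ### Minimality of the two-step measure -/

/-- On each interval `G` times a positive affine denominator is exactly the polynomial of the
corresponding crossing lemma. It remains to check the endpoint signs, which come from `β > 0`, and
the slope at `q`, which is the curvature bound. -/
theorem isParisiMeasure_stepDensity {p s : ℕ} (hp : 2 < p) (hps : p + 1 < s) {lam : ℝ}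
    (hlam : lam ∈ Icc (0 : ℝ) 1) {q α β Δ M N : ℝ} (hq : q ∈ Ioo (0 : ℝ) 1) (hα : 0 < α)
    (hβ : 0 < β) (hΔ : 0 < Δ) (hM : M = Δ + (α + β) * (1 - q)) (hN : N = M + α * q)
    (hX : mixtureD p s lam q = q / (N * M))
    (hD : mixtureD p s lam 1 - mixtureD p s lam q = (1 - q) / (M * Δ))
    (hcurv : mixtureD2 p s lam q * M ^ 2 ≤ 1)
    (hl : ∫ x in (0 : ℝ)..q, (mixtureD p s lam x - stepDual 0 q α β Δ x) = 0)
    (hr : ∫ x in q..1, (mixtureD p s lam x - stepDual 0 q α β Δ x) = 0) :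
    IsParisiMeasure (mixture p s lam) (orderMeasure (stepDensity 0 q α β) Δ) := by
  have hs : 2 < s := by omega
  have h1q : 0 < 1 - q := sub_pos.2 hq.2
  have hMpos : 0 < M := by rw [hM]; have := mul_pos (add_pos hα hβ) h1q; linarith
  have hNM : M < N := by rw [hN]; have := mul_pos hα hq.1; linarith
  have hNpos : 0 < N := hMpos.trans hNM
  have hq0 := hq.1
  have hWq := stepDual_at hq hα hMpos hM hN
  have hW1 := stepDual_one hq hα hβ hΔ hMpos hM
  have hXNM : mixtureD p s lam q * (N * M) = q := by rw [hX]; field_simp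
  have hX0 : 0 < mixtureD p s lam q := mixtureD_pos hp hs hlam hq.1
  have hadm : Admissible (stepDensity 0 q α β) Δ := admissible_stepDensity hα.le hβ.le hΔ
  have hcm := continuous_mixtureD p s lam
  have hGl : ∀ x ∈ Icc 0 q, N - α * x > 0 ∧ mixtureD p s lam x - stepDual 0 q α β Δ x =
      (mixtureD p s lam x * (N ^ 2 - N * α * x) - 1 * x) / (N * (N - α * x)) := by
    intro x hx
    have h : 0 < N - α * x := by rw [hN]; nlinarith [mul_le_mul_of_nonneg_left hx.2 hα.le]
    refine ⟨h, ?_⟩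
    rw [stepDual_left hq hα hMpos hM hN hx, sub_zero]
    have hne := (mul_pos hNpos h).ne'
    rw [eq_div_iff hne, sub_mul, div_mul_cancel₀ _ hne]
    ring
  have hGr : ∀ x ∈ Icc q 1, M - (α + β) * (x - q) > 0 ∧
      mixtureD p s lam x - stepDual 0 q α β Δ x =
      ((mixtureD p s lam x - mixtureD p s lam q) *
        (M * (M + (α + β) * q) - M * (α + β) * x) - (x - q) * 1) /
        (M * (M - (α + β) * (x - q))) := by
    intro x hx
    have h : 0 < M - (α + β) * (x - q) := by
      rw [hM]; nlinarith [mul_le_mul_of_nonneg_left hx.2 (add_pos hα hβ).le]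
    refine ⟨h, ?_⟩
    rw [stepDual_right hq hα hβ hΔ hMpos hM hx, hWq, ← hX]
    have hne := (mul_pos hMpos h).ne'
    rw [eq_div_iff hne, ← sub_sub, sub_mul, div_mul_cancel₀ _ hne]
    ring
  refine isParisiMeasure_of_crossing (Φ := stepTail 0 q α β Δ) (q := q) (m₁ := α) (m₂ := α + β)
    hadm (by rwa [deriv_mixture]) ?_ (continuous_stepTail 0 q α β Δ)
    (fun x => hΔ.trans_le (le_stepTail Δ hα.le hβ.le x)) ?_ hq ?_ ?_ ?_ ?_ ?_ ?_ ?_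
  · intro x hx
    rw [deriv_mixture]
    rcases hx.1.eq_or_lt with h | h
    · rw [← h, mixtureD_zero hp hs]
    · exact (mixtureD_pos hp hs hlam h).le
  · intro x hx
    rw [orderMeasure_Ioc (integrableOn_stepDensity _ _ _ _) hadm.nonneg hΔ.le hx,
      stepTail_eq zero_le_one hq.2.le α β Δ hx]
  · intro x hx
    simp [stepDensity, jump, hx.1, not_le.2 hx.2]
  · intro x hx
    simp [stepDensity, jump, hx.1, hq.1.le.trans hx.1]
  · rw [deriv_mixture]
    exact hW1.trans (by rw [hWq, ← hX, ← hD]; ring)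
  · rw [deriv_mixture]; exact hl
  · rw [deriv_mixture]; exact hr
  · rw [deriv_mixture]
    intro x y hx hxy hyq hGx hGy
    change 0 < mixtureD p s lam x - stepDual 0 q α β Δ x at hGx
    change mixtureD p s lam y - stepDual 0 q α β Δ y < 0 at hGy
    have hx0 : 0 < x := by
      refine hx.lt_of_ne ?_
      rintro rfl
      simp [mixtureD_zero hp hs, stepDual] at hGx
    have hyq' : y < q := by
      refine hyq.lt_of_ne ?_
      rintro rfl
      rw [hWq, ← hX, sub_self] at hGy
      exact lt_irrefl _ hGy
    obtain ⟨px, ex⟩ := hGl x ⟨hx, hxy.le.trans hyq⟩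
    obtain ⟨py, ey⟩ := hGl y ⟨hx.trans hxy.le, hyq⟩
    rw [ex, div_pos_iff_of_pos_right (mul_pos hNpos px)] at hGx
    rw [ey, div_lt_iff₀ (mul_pos hNpos py), zero_mul] at hGy
    have hNα : N ^ 2 - N * α * q = N * M := by rw [hN]; ring
    refine no_crossing_left hp hps hlam (A := N ^ 2) (z := N * α) (C := 1) (by positivity) hq.2
      ?_ ?_ ?_ hx0 hxy hyq' (by linarith) (by linarith)
    · rw [hNα, hXNM, one_mul]
    · rw [hNα]
      have : mixtureD2 p s lam q * (N * M) ≤ N / M := by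
        rw [le_div_iff₀ hMpos]
        nlinarith
      have e : N * α * mixtureD p s lam q = N / M - 1 := by
        rw [hX, hN]
        field_simp
        ring
      linarith
    -- This is positivity of `ξ' - W` at `1` with the left branch of `W` continued past `q`. That
    -- continuation uses the smaller slope `α`, hence a larger tail, and stays below the true value
    -- `W(1) = ξ'(1)`.
    · have e : mixtureD p s lam 1 = q / (N * M) + (1 - q) / (M * Δ) := by linarith
      rw [e, ← sub_pos]
      have : (q / (N * M) + (1 - q) / (M * Δ)) * (N ^ 2 - N * α) - 1 =
          β * (1 - q) * ((1 - q) * Δ + α * (1 - q) + β * (1 - q) * (1 - q)) / (M * Δ) := by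
        field_simp
        rw [hN, hM]
        ring
      rw [this]
      positivity
  · rw [deriv_mixture]
    intro x y hx hxy hy1 hGx hGy
    change 0 < mixtureD p s lam x - stepDual 0 q α β Δ x at hGx
    change mixtureD p s lam y - stepDual 0 q α β Δ y < 0 at hGy
    have hqx : q < x := by
      refine hx.lt_of_ne ?_
      rintro rfl
      rw [hWq, ← hX, sub_self] at hGx
      exact lt_irrefl _ hGx
    have hy1' : y < 1 := by
      refine hy1.lt_of_ne ?_
      rintro rfl
      rw [hW1, hWq, ← hX, ← hD] at hGy
      linarith
    obtain ⟨px, ex⟩ := hGr x ⟨hx, hxy.le.trans hy1⟩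
    obtain ⟨py, ey⟩ := hGr y ⟨hx.trans hxy.le, hy1⟩
    rw [ex, div_pos_iff_of_pos_right (mul_pos hMpos px)] at hGx
    rw [ey, div_lt_iff₀ (mul_pos hMpos py), zero_mul] at hGy
    refine no_crossing_right hp hps hlam (z := M * (α + β)) (by positivity) hq.1 rfl ?_ ?_ ?_ ?_
      hqx hxy hy1' hGx hGy
    · simp only [mixtureD_zero hp hs]
      -- Likewise the right branch of `W`, continued back to `0`, is positive there while `ξ'(0) =
      -- 0`, because `N = M + α q < M + (α + β) q`.
      have : q < mixtureD p s lam q * (M * (M + (α + β) * q)) := by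
        conv_lhs => rw [← hXNM]
        refine mul_lt_mul_of_pos_left ?_ hX0
        rw [mul_comm N]
        refine mul_lt_mul_of_pos_left ?_ hMpos
        rw [hN]
        nlinarith [mul_pos hβ hq.1]
      linarith
    · ring
    · rw [sub_self, mul_zero, sub_zero]
      linarith [show M * (M + (α + β) * q) - M * (α + β) * q = M ^ 2 by ring,
        congrArg (mixtureD2 p s lam q * ·)
          (show M * (M + (α + β) * q) - M * (α + β) * q = M ^ 2 by ring)]
    · simp only [hD, show M * (M + (α + β) * q) - M * (α + β) * 1 = M * Δ by rw [hM]; ring]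
      field_simp
      ring

/-! ### Two-point supports -/

lemma support_smul_dirac {c : ENNReal} (hc : c ≠ 0) (a : ℝ) :
    (c • Measure.dirac a : Measure ℝ).support = {a} := by
  ext x
  rw [Measure.mem_support_iff_forall, mem_singleton_iff]
  constructor
  · intro h
    by_contra hx
    have := h {a}ᶜ (isOpen_compl_singleton.mem_nhds hx)
    rw [Measure.smul_apply, Measure.dirac_apply' _ (measurableSet_singleton a).compl] at this
    simp at this
  · rintro rfl U hU
    rw [Measure.smul_apply, Measure.dirac_apply_of_mem (mem_of_mem_nhds hU)]
    simpa using pos_iff_ne_zero.2 hc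

lemma isRSB_two_of_stepDensity {ξ : ℝ → ℝ} {q α β Δ : ℝ} (hq : q ∈ Ioo (0 : ℝ) 1) (hα : 0 < α)
    (hβ : 0 < β) (hΔ : 0 < Δ)
    (h : IsParisiMeasure ξ (orderMeasure (stepDensity 0 q α β) Δ)) : IsRSB 2 ξ := by
  refine ⟨stepDensity 0 q α β, Δ,
    ENNReal.ofReal α • Measure.dirac 0 + ENNReal.ofReal β • Measure.dirac q,
    admissible_stepDensity hα.le hβ.le hΔ, h, ⟨?_, ?_⟩, ?_⟩
  · simp [measurableSet_Ico, hq.1.le, hq.2]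
  · intro x hx
    by_cases hqx : q ≤ x
    · simp [stepDensity, jump, hx.1, hqx, hq.1.le, ENNReal.ofReal_add hα.le hβ.le]
    · simp [stepDensity, jump, hx.1, hqx]
  · rw [Measure.support_add, support_smul_dirac (by simpa using hα),
      support_smul_dirac (by simpa using hβ), inter_eq_self_of_subset_left]
    · have : ({0} ∪ {q} ∪ {1} : Set ℝ) = {0, q, 1} := by
        ext x; simp; tauto
      rw [this, encard_insert_of_notMem (by simp [hq.1.ne]),
        encard_insert_of_notMem (by simp [hq.2.ne]), encard_singleton]
      norm_num
    · rintro x (rfl | rfl)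
      · simp
      · exact ⟨hq.1.le, hq.2⟩

/-- The complement of the support is null, so `ρ` lives on two atoms. Each is charged because the
complement of the other is a neighbourhood of it, and each is finite because `ρ([0, u]) = γ(u)`. -/
lemma eq_stepDensity_of_support {γ : ℝ → ℝ} {ρ : Measure ℝ} {a b : ℝ}
    (hγ : ∀ x ∈ Ico (0 : ℝ) 1, 0 ≤ γ x) (hρ : IsInducedMeasure γ ρ) (hab : a < b)
    (hS : ρ.support ∩ Ico 0 1 = {a, b}) :
    ∃ α β : ℝ, 0 < α ∧ 0 < β ∧ ∀ x ∈ Ico (0 : ℝ) 1, γ x = stepDensity a b α β x := by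
  have ha : a ∈ ρ.support ∩ Ico 0 1 := by rw [hS]; simp
  have hb : b ∈ ρ.support ∩ Ico 0 1 := by rw [hS]; simp
  have hnull : ρ {a, b}ᶜ = 0 := by
    rw [← hS, compl_inter]
    exact measure_union_null Measure.measure_compl_support hρ.1
  have hinter : ∀ s : Set ℝ, ρ s = ρ (s ∩ {a, b}) := by
    intro s
    refine le_antisymm ?_ (measure_mono inter_subset_left)
    calc ρ s ≤ ρ (s ∩ {a, b} ∪ {a, b}ᶜ) := by
          refine measure_mono fun x hx => ?_
          by_cases h : x ∈ ({a, b} : Set ℝ)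
          · exact Or.inl ⟨hx, h⟩
          · exact Or.inr h
      _ ≤ ρ (s ∩ {a, b}) + ρ {a, b}ᶜ := measure_union_le _ _
      _ = ρ (s ∩ {a, b}) := by rw [hnull, add_zero]
  have hfin : ∀ u ∈ Ico (0 : ℝ) 1, ρ {u} ≠ ⊤ := by
    intro u hu
    refine ne_top_of_le_ne_top ?_
      (measure_mono (show {u} ⊆ Icc 0 u from singleton_subset_iff.2 ⟨hu.1, le_rfl⟩))
    rw [hρ.2 u hu]
    exact ENNReal.ofReal_ne_top
  have hpa : 0 < ρ {a} := by
    have := (Measure.mem_support_iff_forall a).1 ha.1 {b}ᶜ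
      (isOpen_compl_singleton.mem_nhds hab.ne)
    rwa [hinter, show ({b}ᶜ ∩ {a, b} : Set ℝ) = {a} by
      ext x; simp only [mem_inter_iff, mem_compl_iff, mem_singleton_iff, mem_insert_iff]
      constructor
      · tauto
      · rintro rfl; exact ⟨hab.ne, Or.inl rfl⟩] at this
  have hpb : 0 < ρ {b} := by
    have := (Measure.mem_support_iff_forall b).1 hb.1 {a}ᶜ
      (isOpen_compl_singleton.mem_nhds hab.ne')
    rwa [hinter, show ({a}ᶜ ∩ {a, b} : Set ℝ) = {b} by
      ext x; simp only [mem_inter_iff, mem_compl_iff, mem_singleton_iff, mem_insert_iff]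
      constructor
      · tauto
      · rintro rfl; exact ⟨hab.ne', Or.inr rfl⟩] at this
  have hfa := hfin a ha.2
  have hfb := hfin b hb.2
  have hα := ENNReal.toReal_pos hpa.ne' hfa
  have hβ := ENNReal.toReal_pos hpb.ne' hfb
  refine ⟨(ρ {a}).toReal, (ρ {b}).toReal, hα, hβ, fun x hx => ?_⟩
  have hγx : γ x = (ρ (Icc 0 x ∩ {a, b})).toReal := by
    rw [← hinter, hρ.2 x hx, ENNReal.toReal_ofReal (hγ x hx)]
  rw [hγx]
  unfold stepDensity jump
  rcases lt_or_ge x a with h | h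
  · have : Icc 0 x ∩ {a, b} = ∅ := by
      ext y
      simp only [mem_inter_iff, mem_Icc, mem_insert_iff, mem_singleton_iff, mem_empty_iff_false,
        iff_false]
      rintro ⟨⟨_, h1⟩, rfl | rfl⟩ <;> linarith
    simp [this, not_le.2 h, not_le.2 (h.trans hab)]
  rcases lt_or_ge x b with h' | h'
  · have : Icc 0 x ∩ {a, b} = {a} := by
      ext y
      simp only [mem_inter_iff, mem_Icc, mem_insert_iff, mem_singleton_iff]
      constructor
      · rintro ⟨⟨_, h1⟩, rfl | rfl⟩
        · rfl
        · linarith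
      · rintro rfl
        exact ⟨⟨ha.2.1, h⟩, Or.inl rfl⟩
    simp [this, h, not_le.2 h']
  · have : Icc 0 x ∩ {a, b} = {a, b} := by
      refine inter_eq_self_of_subset_right ?_
      rintro y (rfl | rfl)
      · exact ⟨ha.2.1, h⟩
      · exact ⟨hb.2.1, h'⟩
    rw [this, insert_eq, measure_union (by simpa using hab.ne) (measurableSet_singleton b),
      ENNReal.toReal_add hfa hfb]
    simp [h, h']

lemma IsRSB.exists_stepDensity {ξ : ℝ → ℝ} (h : IsRSB 2 ξ) :
    ∃ a b α β Δ : ℝ, a ∈ Ico (0 : ℝ) 1 ∧ b ∈ Ico (0 : ℝ) 1 ∧ a < b ∧ 0 < α ∧ 0 < β ∧ 0 < Δ ∧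
      IsParisiMeasure ξ (orderMeasure (stepDensity a b α β) Δ) := by
  obtain ⟨γ, Δ, ρ, hadm, hmin, hρ, hcard⟩ := h
  have hcard' : (ρ.support ∩ Ico 0 1).encard = 2 := by
    rw [union_singleton, encard_insert_of_notMem (by simp)] at hcard
    exact (ENat.add_left_injective_of_ne_top ENat.one_ne_top) hcard
  obtain ⟨a, b, hne, hS⟩ := encard_eq_two.1 hcard'
  wlog hab : a < b generalizing a b
  · exact this b a hne.symm (by rw [hS, pair_comm]) (lt_of_le_of_ne (not_lt.1 hab) hne.symm)
  obtain ⟨α, β, hα, hβ, hγ⟩ := eq_stepDensity_of_support hadm.nonneg hρ hab hS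
  have ha : a ∈ ρ.support ∩ Ico 0 1 := by rw [hS]; simp
  have hb : b ∈ ρ.support ∩ Ico 0 1 := by rw [hS]; simp
  exact ⟨a, b, α, β, Δ, ha.2, hb.2, hab, hα, hβ, hadm.pos, by rwa [← orderMeasure_congr hγ]⟩

/-! ### The two implications -/

lemma exists_of_isParisiMeasure_stepDensity {p s : ℕ} (hp : 2 < p) (hs : 2 < s) {lam : ℝ}
    (hlam : lam ∈ Icc (0 : ℝ) 1) {a b α β Δ : ℝ} (ha : a ∈ Ico (0 : ℝ) 1)
    (hb : b ∈ Ico (0 : ℝ) 1) (hab : a < b) (hα : 0 < α) (hβ : 0 < β) (hΔ : 0 < Δ)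
    (hmin : IsParisiMeasure (mixture p s lam) (orderMeasure (stepDensity a b α β) Δ)) :
    ∃ z₂ q : ℝ, 0 < z₂ ∧ q ∈ Ioo (0 : ℝ) 1 ∧
      mixtureD p s lam 1 * q / mixtureD p s lam q < 1 + z₂ ∧
      1 + z₂ ≤ (mixtureD p s lam 1 - mixtureD p s lam q) / (mixtureD2 p s lam q * (1 - q)) ∧
      f1 (mixture p s lam) q z₂ = 0 ∧ f2 (mixture p s lam) q z₂ = 0 := by
  have hcm := continuous_mixtureD p s lam
  have hW := continuous_stepDual a b hα.le hβ.le hΔ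
  have hder := deriv_mixture p s lam
  obtain ⟨h1, hnonneg, hga, hgb⟩ := hmin.stationary_stepDensity (by rwa [hder])
    (fun x hx => by
      rw [hder]
      rcases hx.1.eq_or_lt with h | h
      · rw [← h, mixtureD_zero hp hs]
      · exact (mixtureD_pos hp hs hlam h).le) ha hb hα hβ hΔ
  rw [hder] at h1 hnonneg hga hgb
  set G : ℝ → ℝ := fun x => mixtureD p s lam x - stepDual a b α β Δ x with hGdef
  have hG : Continuous G := hcm.sub hW
  have hGi : ∀ u v, IntervalIntegrable G volume u v := fun u v => hG.intervalIntegrable u v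
  have hcrit : ∀ u ∈ Ioo (0 : ℝ) 1, ∫ x in u..1, G x = 0 → G u = 0 := by
    intro u hu h0
    -- The tail integral is nonnegative on `[0, 1)`, so an interior zero is a minimum and its
    -- derivative `-G u` vanishes.
    have hmin : IsLocalMin (fun v => ∫ x in v..1, G x) u := by
      filter_upwards [Ioo_mem_nhds hu.1 hu.2] with v hv
      rw [h0]
      exact hnonneg v ⟨hv.1.le, hv.2⟩
    have hd : HasDerivAt (fun v => ∫ x in v..1, G x) (-G u) u :=
      intervalIntegral.integral_hasDerivAt_left (hGi u 1)
        (hG.stronglyMeasurableAtFilter _ _) hG.continuousAt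
    exact neg_eq_zero.1 (hmin.hasDerivAt_eq_zero hd)
  have hb' : b ∈ Ioo (0 : ℝ) 1 := ⟨ha.1.trans_lt hab, hb.2⟩
  have hGb := hcrit b hb' hgb
  -- If `a > 0`, then `W` is linear on `[0, a]` and meets `ξ'` at `a`. As `ξ'(x)/x` is strictly
  -- increasing, `G < 0` on `(0, a)`, and the tail integral at `0` would be negative.
  have ha0 : a = 0 := by
    by_contra hne
    have hapos : 0 < a := lt_of_le_of_ne ha.1 (Ne.symm hne)
    have hGa := hcrit a ⟨hapos, ha.2⟩ hga
    obtain ⟨k, hk⟩ : ∃ k : ℝ, ∀ x ∈ Icc 0 a, stepDual a b α β Δ x = x * k := by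
      refine ⟨((Δ + (α * (1 - a) + β * (1 - b))) ^ 2)⁻¹, fun x hx => ?_⟩
      have : ∫ t in (0 : ℝ)..x, (stepTail a b α β Δ t ^ 2)⁻¹ =
          ∫ _ in (0 : ℝ)..x, ((Δ + (α * (1 - a) + β * (1 - b))) ^ 2)⁻¹ := by
        refine intervalIntegral.integral_congr fun t ht => ?_
        rw [uIcc_of_le hx.1] at ht
        simp only [stepTail, cutTail_of_le ha.2.le (ht.2.trans hx.2),
          cutTail_of_le hb.2.le ((ht.2.trans hx.2).trans hab.le)]
      rw [stepDual, this, intervalIntegral.integral_const, smul_eq_mul, sub_zero]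
    have hXa : mixtureD p s lam a = a * k := by
      rw [← hk a ⟨hapos.le, le_rfl⟩]
      exact sub_eq_zero.1 hGa
    have hneg : 0 < ∫ x in (0 : ℝ)..a, -G x := by
      refine intervalIntegral.intervalIntegral_pos_of_pos_on (hG.neg.intervalIntegrable _ _)
        (fun x hx => ?_) hapos
      have := mixtureD_mul_lt hp hs hlam hx.1 hx.2
      rw [hXa] at this
      have : mixtureD p s lam x < x * k := by
        refine lt_of_mul_lt_mul_right ?_ hapos.le
        linarith
      simp only [hGdef, hk x ⟨hx.1.le, hx.2.le⟩]
      linarith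
    have h0 := hnonneg 0 (by simp)
    rw [← intervalIntegral.integral_add_adjacent_intervals (hGi 0 a) (hGi a 1), hga] at h0
    rw [intervalIntegral.integral_neg] at hneg
    linarith
  subst ha0
  have h1b : 0 < 1 - b := sub_pos.2 hb.2
  set M := Δ + (α + β) * (1 - b) with hM
  set N := M + α * b with hN
  have hMpos : 0 < M := by have := mul_pos (add_pos hα hβ) h1b; linarith
  have hNpos : 0 < N := by have := mul_pos hα hb'.1; linarith
  have hb0 := hb'.1
  have hX : mixtureD p s lam b = b / (N * M) := by
    rw [← stepDual_at hb' hα hMpos hM hN]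
    exact sub_eq_zero.1 hGb
  have hD : mixtureD p s lam 1 - mixtureD p s lam b = (1 - b) / (M * Δ) := by
    rw [← h1, stepDual_one hb' hα hβ hΔ hMpos hM, stepDual_at hb' hα hMpos hM hN, hX]
    ring
  have hd : ∀ x, HasDerivAt (mixture p s lam) (deriv (mixture p s lam) x) x := fun x => by
    rw [hder]; exact hasDerivAt_mixture p s lam x
  have hΔM : Δ < M := by have := mul_pos (add_pos hα hβ) h1b; linarith
  refine ⟨M / Δ - 1, b, ?_, hb', ?_, ?_, ?_, ?_⟩
  · rw [sub_pos, one_lt_div hΔ]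
    exact hΔM
  · have e : mixtureD p s lam 1 = b / (N * M) + (1 - b) / (M * Δ) := by linarith
    have : 1 + (M / Δ - 1) - mixtureD p s lam 1 * b / mixtureD p s lam b =
        β * b * (1 - b) / Δ := by
      rw [hX, e]
      field_simp
      rw [hN, hM]
      ring
    have : 0 < β * b * (1 - b) / Δ := by positivity
    linarith
  -- Otherwise `G' (b) > 0`, so `G > 0` just to the right of `b`, and the tail integral, zero at
  -- `b`, would become negative.
  · have hcurv : mixtureD2 p s lam b ≤ (M ^ 2)⁻¹ := by
      by_contra! hlt
      have hdG : HasDerivAt G (mixtureD2 p s lam b - (M ^ 2)⁻¹) b := by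
        have := (hasDerivAt_mixtureD p s lam b).sub (hasDerivAt_stepDual 0 b hα.le hβ.le hΔ b)
        rw [stepTail_right hb' hM ⟨le_rfl, hb.2.le⟩, sub_self, mul_zero, sub_zero] at this
        exact this
      have hev := (hasDerivAt_iff_tendsto_slope.1 hdG).eventually_const_lt (sub_pos.2 hlt)
      have hev' := hev.filter_mono (nhdsWithin_mono b fun x (hx : b < x) => hx.ne')
      obtain ⟨c, hc, hc'⟩ := mem_nhdsGT_iff_exists_Ioo_subset.1 hev'
      set d := min c 1 with hddef
      have hbd : b < d := lt_min hc hb.2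
      obtain ⟨e, he1, he2⟩ := exists_between hbd
      have hpos : 0 < ∫ x in b..e, G x := by
        refine intervalIntegral.intervalIntegral_pos_of_pos_on (hGi b e) (fun x hx => ?_) he1
        have := hc' ⟨hx.1, hx.2.trans (he2.trans_le (min_le_left _ _))⟩
        simp only [mem_ofPred_eq, slope_def_field, hGb, sub_zero] at this
        exact (div_pos_iff_of_pos_right (sub_pos.2 hx.1)).1 this
      have hge := hnonneg e ⟨hb0.le.trans he1.le, he2.trans_le (min_le_right _ _)⟩
      rw [← intervalIntegral.integral_add_adjacent_intervals (hGi b e) (hGi e 1)] at hgb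
      linarith
    have hX2 := mixtureD2_pos hp hs hlam hb0
    rw [hD, le_div_iff₀ (by positivity)]
    calc (1 + (M / Δ - 1)) * (mixtureD2 p s lam b * (1 - b))
        = M / Δ * (1 - b) * mixtureD2 p s lam b := by ring
      _ ≤ M / Δ * (1 - b) * (M ^ 2)⁻¹ := by gcongr
      _ = (1 - b) / (M * Δ) := by field_simp
  · rw [f1_eq_integral hd (by rwa [hder]) (mixture_zero hp hs lam) hb' hα hβ hΔ hMpos hM hN
      (by rw [hder]; exact hX) (by rw [hder]; exact hD), hder]
    rw [← intervalIntegral.integral_add_adjacent_intervals (hGi 0 b) (hGi b 1), hgb,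
      add_zero] at hga
    exact mul_eq_zero_of_right _ hga
  · rw [f2_eq_integral hd (by rwa [hder]) (mixture_one p s lam) hb' hα hβ hΔ hMpos hM hN
      (by rw [hder]; exact hX) (by rw [hder]; exact hD), hder]
    exact neg_eq_zero.2 hgb

/-- The relations `1 + z = M / Δ`, `ξ'(1) - ξ'(q) = (1 - q) / (M Δ)` and `ξ'(q) = q / (N M)`
determine `Δ, M, N`, and then the jumps. The upper bound on `1 + z` yields the curvature bound and
`α > 0`; the lower bound yields `β > 0`. -/
lemma isRSB_two_of_exists {p s : ℕ} (hp : 2 < p) (hps : p + 1 < s) {lam : ℝ}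
    (hlam : lam ∈ Icc (0 : ℝ) 1) {z q : ℝ} (hz : 0 < z) (hq : q ∈ Ioo (0 : ℝ) 1)
    (h1 : mixtureD p s lam 1 * q / mixtureD p s lam q < 1 + z)
    (h2 : 1 + z ≤ (mixtureD p s lam 1 - mixtureD p s lam q) / (mixtureD2 p s lam q * (1 - q)))
    (hf1 : f1 (mixture p s lam) q z = 0) (hf2 : f2 (mixture p s lam) q z = 0) :
    IsRSB 2 (mixture p s lam) := by
  have hs : 2 < s := by omega
  have hq0 := hq.1
  have h1q : 0 < 1 - q := sub_pos.2 hq.2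
  have hcm := continuous_mixtureD p s lam
  have hder := deriv_mixture p s lam
  have hX := mixtureD_pos hp hs hlam hq.1
  have hX2 := mixtureD2_pos hp hs hlam hq.1
  have hXX2 := mixtureD_lt_mul_mixtureD2 hp hs hlam hq.1
  have hDpos : 0 < mixtureD p s lam 1 - mixtureD p s lam q := sub_pos.2
    (mixtureD_strictMonoOn hp hs hlam (mem_Ici.2 hq.1.le) (mem_Ici.2 zero_le_one) hq.2)
  set X := mixtureD p s lam q with hXdef
  set D := mixtureD p s lam 1 - X with hDdef
  set Δ := √((1 - q) / (D * (1 + z))) with hΔdef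
  have hΔ : 0 < Δ := Real.sqrt_pos.2 (by positivity)
  have hΔsq : Δ ^ 2 = (1 - q) / (D * (1 + z)) := Real.sq_sqrt (by positivity)
  set M := Δ * (1 + z) with hMdef
  have hMpos : 0 < M := by positivity
  have hDM : D = (1 - q) / (M * Δ) := by
    rw [eq_div_iff (by positivity), hMdef,
      show D * (Δ * (1 + z) * Δ) = D * (1 + z) * Δ ^ 2 by ring, hΔsq]
    field_simp
  set N := q / (X * M) with hNdef
  have hNpos : 0 < N := by positivity
  have hXN : X = q / (N * M) := by
    rw [hNdef]
    field_simp
  have hM2 : M ^ 2 = (1 - q) * (1 + z) / D := by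
    rw [hMdef, mul_pow, hΔsq]
    field_simp
  have hcurv : mixtureD2 p s lam q * M ^ 2 ≤ 1 := by
    rw [le_div_iff₀ (by positivity)] at h2
    rw [hM2, ← mul_div_assoc, div_le_one hDpos]
    linarith
  have hMN : M < N := by
    rw [hNdef, lt_div_iff₀ (by positivity)]
    have : X * M ^ 2 < q * mixtureD2 p s lam q * M ^ 2 := by gcongr
    nlinarith
  set α := (N - M) / q with hαdef
  have hα : 0 < α := div_pos (sub_pos.2 hMN) hq0
  set β := (M - Δ) / (1 - q) - α with hβdef
  have hzM : 1 + z = M / Δ := by rw [hMdef]; field_simp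
  have hβ : 0 < β := by
    have e : 1 + z - mixtureD p s lam 1 * q / X = β * q * (1 - q) / Δ := by
      rw [show mixtureD p s lam 1 = X + D by rw [hDdef]; ring, hzM, hβdef, hαdef, hDM, hXN]
      field_simp
      ring
    have : 0 < β * q * (1 - q) / Δ := by linarith
    have h3 : 0 < q * (1 - q) / Δ := by positivity
    refine pos_of_mul_pos_left (b := q * (1 - q) / Δ) ?_ h3.le
    rwa [← mul_div_assoc, ← mul_assoc]
  have hM : M = Δ + (α + β) * (1 - q) := by
    rw [hβdef]
    field_simp
    ring
  have hN : N = M + α * q := by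
    rw [hαdef]
    field_simp
    ring
  have hd : ∀ x, HasDerivAt (mixture p s lam) (deriv (mixture p s lam) x) x := fun x => by
    rw [hder]; exact hasDerivAt_mixture p s lam x
  have hzM' : z = M / Δ - 1 := by linarith
  rw [hzM', f1_eq_integral hd (by rwa [hder]) (mixture_zero hp hs lam) hq hα hβ hΔ hMpos hM hN
    (by rw [hder]; exact hXN) (by rw [hder]; exact hDM), hder] at hf1
  rw [hzM', f2_eq_integral hd (by rwa [hder]) (mixture_one p s lam) hq hα hβ hΔ hMpos hM hN
    (by rw [hder]; exact hXN) (by rw [hder]; exact hDM), hder] at hf2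
  exact isRSB_two_of_stepDensity hq hα hβ hΔ (isParisiMeasure_stepDensity hp hps hlam hq hα hβ hΔ
    hM hN hXN hDM hcurv
    ((mul_eq_zero.1 hf1).resolve_left (pow_ne_zero 2 (sub_pos.2 hMN).ne')) (neg_eq_zero.1 hf2))

lemma AuffingerZeng.h1_h2 {p s : ℕ} (hp : 2 < p) (hs : 2 < s) {lam : ℝ}
    (hlam : lam ∈ Icc (0 : ℝ) 1) {q z₁ z₂ : ℝ} (h : AuffingerZeng (mixture p s lam) q z₁ z₂) :
    0 < h1 (mixture p s lam) q z₁ z₂ 1 ∧ h2 (mixture p s lam) q z₂ 0 < 0 := by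
  obtain ⟨hq, -, hz, hsum, -, -, -⟩ := h
  rw [deriv_mixture] at hsum
  have hq0 := hq.1
  have h1q : 0 < 1 - q := sub_pos.2 hq.2
  have hX := mixtureD_pos hp hs hlam hq.1
  have hDpos : 0 < mixtureD p s lam 1 - mixtureD p s lam q := sub_pos.2
    (mixtureD_strictMonoOn hp hs hlam (mem_Ici.2 hq.1.le) (mem_Ici.2 zero_le_one) hq.2)
  rw [div_lt_iff₀ hq0] at hz
  rw [eq_div_iff (by positivity)] at hsum
  unfold h1 h2
  rw [deriv_mixture, mixtureD_zero hp hs]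
  set X := mixtureD p s lam q with hXdef
  set Y := mixtureD p s lam 1 with hYdef
  -- Eliminating `q (Y - X)` by (1) leaves `X (z₂ q - (1 - q) z₁)`. This quantity equals `-h₂(0)`,
  -- and `X h₁(1)` is `Y - X` times it.
  have key : 0 < (1 + z₂) * X - q * Y := by
    have : (1 + z₂) * X - q * Y = X * (z₂ * q - (1 - q) * z₁) := by linarith
    rw [this]
    exact mul_pos hX (sub_pos.2 hz)
  constructor
  · have : X * (Y * (q + q * z₁ + q * z₂ - z₁ * 1) - (1 + z₂) * X * 1) =
        (Y - X) * ((1 + z₂) * X - q * Y) := by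
      linear_combination (-Y) * hsum
    refine pos_of_mul_pos_right (a := X) ?_ hX.le
    rw [this]
    exact mul_pos hDpos key
  · linarith

end

end SphericalSpinGlass

theorem theorem16 (p s : ℕ) (hp : 2 < p) (hps : p + 1 < s) (lam : ℝ)
    (hlam : lam ∈ Set.Icc (0 : ℝ) 1) (ξ : ℝ → ℝ)
    (hξ : ξ = SphericalSpinGlass.mixture p s lam) :
    (SphericalSpinGlass.IsRSB 2 ξ ↔
      ∃ z₂ q : ℝ, 0 < z₂ ∧ q ∈ Set.Ioo (0 : ℝ) 1 ∧
        deriv ξ 1 * q / deriv ξ q < 1 + z₂ ∧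
        1 + z₂ ≤ (deriv ξ 1 - deriv ξ q) / (deriv (deriv ξ) q * (1 - q)) ∧
        SphericalSpinGlass.f1 ξ q z₂ = 0 ∧ SphericalSpinGlass.f2 ξ q z₂ = 0) ∧
    (∀ q z₁ z₂ : ℝ, SphericalSpinGlass.AuffingerZeng ξ q z₁ z₂ →
      0 < SphericalSpinGlass.h1 ξ q z₁ z₂ 1 ∧ SphericalSpinGlass.h2 ξ q z₂ 0 < 0) := by
  have hs : 2 < s := by omega
  subst hξ
  refine ⟨?_, fun q z₁ z₂ h => h.h1_h2 hp hs hlam⟩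
  rw [SphericalSpinGlass.deriv_mixture, SphericalSpinGlass.deriv_mixtureD]
  constructor
  · intro h
    obtain ⟨a, b, α, β, Δ, ha, hb, hab, hα, hβ, hΔ, hmin⟩ := h.exists_stepDensity
    exact SphericalSpinGlass.exists_of_isParisiMeasure_stepDensity hp hs hlam ha hb hab hα hβ hΔ
      hmin
  · rintro ⟨z, q, hz, hq, h1, h2, hf1, hf2⟩
    exact SphericalSpinGlass.isRSB_two_of_exists hp hps hlam hz hq h1 h2 hf1 hf2
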